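/- There is an absolute constant $c>0$ such that the following holds. Let $\mathcal{D}=(D_v)_{v\in V}$ be a finite family of closed disks in the Euclidean plane in general position (no two disks are identical or tangent, i.e. no two of the bounding circles meet in exactly one point, and no point lies on the boundaries of three of the disks), and let $G$ be the disk graph realized by $\mathcal{D}$, i.e. the graph with vertex set $V$ in which distinct $u,v$ are adjacent if and only if $D_u\cap D_v\neq\emptyset$. The *faces* of $\mathcal D$ are the connected regions into which the bounding circles subdivide the plane. The *arrangement graph* $A_{\mathcal{D}}$ has as vertices the faces that are contained in at least one disk of $\mathcal{D}$, and two distinct faces are adjacent if and only if they have a common boundary arc (that is not a single point). For a disk $D\in\mathcal{D}$ let $A_{\mathcal{D}}[D]$ be the subgraph of $A_{\mathcal{D}}$ induced by the faces contained in $D$. Let $r$ be the local radius of the realization $\mathcal{D}$, i.e. the maximum over $D\in\mathcal{D}$ of the radius of $A_{\mathcal{D}}[D]$. Let $t'\in\mathbb{N}$. If $A_{\mathcal{D}}$ contains the $t'\times t'$ grid as a minor, then $G$ contains the $t\times t$ grid as a minor for some integer $t\ge c\,t'/\max(r,1)$. In particular, if $G$ is a disk graph of local radius $r$ (the minimum local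 radius of a realization of $G$), this applies to every realization $\mathcal{D}$ of $G$ of local radius $r$. -/

import Mathlib

namespace DiskGrid

/-- The Euclidean plane. -/
abbrev Plane := EuclideanSpace ℝ (Fin 2)

/-- A closed disk in the plane, given by its centre and its (positive) radius. -/
structure Disk where
  center : Plane
  rad : ℝ
  rad_pos : 0 < rad

/-- The points of a closed disk. -/
def Disk.carrier (D : Disk) : Set Plane := Metric.closedBall D.center D.rad

/-- The bounding circle of a disk. -/
def Disk.boundary (D : Disk) : Set Plane := Metric.sphere D.center D.rad

section Families

variable {V : Type*} (D : V → Disk)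

/-- General position: no two disks are identical or tangent (boundaries meeting in exactly one
point), and no point lies on the boundaries of three disks. -/
structure InGeneralPosition : Prop where
  ne_of_ne : ∀ u v : V, u ≠ v → (D u).carrier ≠ (D v).carrier
  not_tangent : ∀ u v : V, u ≠ v → ¬ ∃ p : Plane, (D u).boundary ∩ (D v).boundary = {p}
  no_triple : ∀ u v w : V, u ≠ v → u ≠ w → v ≠ w →
    (D u).boundary ∩ (D v).boundary ∩ (D w).boundary = ∅

/-- The family `D` of disks is a realization of the graph `G`: the disks are in general position
and two distinct vertices are adjacent exactly when their disks intersect. -/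
structure IsRealization (G : SimpleGraph V) : Prop where
  generalPosition : InGeneralPosition D
  adj_iff : ∀ u v : V, u ≠ v → (G.Adj u v ↔ ((D u).carrier ∩ (D v).carrier).Nonempty)

/-- The complement of the union of all bounding circles. -/
def offBoundary : Set Plane := (⋃ v, (D v).boundary)ᶜ

/-- The faces of the arrangement: the connected components of the complement of the union of the
bounding circles. -/
def IsFace (F : Set Plane) : Prop :=
  ∃ x ∈ offBoundary D, F = connectedComponentIn (offBoundary D) x

/-- The vertices of the arrangement graph: the faces contained in at least one disk. -/
abbrev CoveredFace := {F : Set Plane // IsFace D F ∧ ∃ v, F ⊆ (D v).carrier}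

/-- Two sets have a common boundary arc, not merely common boundary points. (For faces of
an arrangement of finitely many circles, whose boundaries consist of finitely many circular arcs,
a connected set of common boundary points with more than one point contains an arc.) -/
def ShareBoundaryArc (F F' : Set Plane) : Prop :=
  ∃ a : Set Plane, a ⊆ frontier F ∩ frontier F' ∧ IsConnected a ∧ a.Nontrivial

/-- The arrangement graph of a family of disks. -/
def arrangementGraph : SimpleGraph (CoveredFace D) where
  Adj F F' := F ≠ F' ∧ ShareBoundaryArc F.1 F'.1
  symm := ⟨fun _ _ h => ⟨h.1.symm, by
    obtain ⟨a, ha, hc⟩ := h.2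
    exact ⟨a, fun x hx => ⟨(ha hx).2, (ha hx).1⟩, hc⟩⟩⟩
  loopless := ⟨fun _ h => h.1 rfl⟩

/-- The subgraph of the arrangement graph induced by the faces contained in a region `R`. -/
def arrangementGraphIn (R : Set Plane) :
    SimpleGraph {F : CoveredFace D | F.1 ⊆ R} :=
  (arrangementGraph D).induce {F : CoveredFace D | F.1 ⊆ R}

/-- The local radius of a family of disks: the maximum, over its disks, of the radius of
the subgraph of the arrangement graph induced by the faces inside the disk. -/
noncomputable def localRadius : ℕ∞ :=
  ⨆ v : V, (arrangementGraphIn D (D v).carrier).radius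

end Families

/-- `H` is a minor of `G`, by a minor model: pairwise disjoint, nonempty, connected
branch sets, with an edge of `G` between the branch sets of any two adjacent vertices of `H`. -/
def IsMinor {W U : Type*} (H : SimpleGraph W) (G : SimpleGraph U) : Prop :=
  ∃ φ : W → Set U,
    (∀ w, (G.induce (φ w)).Connected) ∧
    (∀ w w', w ≠ w' → Disjoint (φ w) (φ w')) ∧
    (∀ w w', H.Adj w w' → ∃ a ∈ φ w, ∃ b ∈ φ w', G.Adj a b)

/-- The `t × t` grid. -/
def grid (t : ℕ) : SimpleGraph (Fin t × Fin t) :=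
  (SimpleGraph.pathGraph t).boxProd (SimpleGraph.pathGraph t)

end DiskGrid

/-!
A grid minor of the arrangement graph `A` is turned into a coarser grid minor of the disk graph `G`
by replacing each branch set, which is a connected set of faces, by the set of disks containing one
of its faces. These sets of disks are connected in `G`, and those at neighbouring grid positions
touch (`connected_disksOver`, `touch_disksOver`), but they overlap. What has to be shown is that
they overlap only locally: a disk that contains faces of two branch sets provides a walk of length
at most `2 * r` in `A` between them, and because `A` is planar such a walk moves by at most `2 * r`
steps in the grid, unless it starts close to the border of the grid. Squares of radius `2 * r`,
placed with spacing `8 * r` (for `r` positive) and joined along straight segments, then give disjoint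
connected sets of disks forming a grid minor of order about `n / r`
(`GridSystem.isMinor_grid`).

Of planarity, only the absence of `K₅` minors is used. If a walk left a branch set and next
entered a branch set that is not among its eight neighbours, then the ring of these eight neighbours,
cut into three arcs, the given branch set, and the rest of the grid would form a `K₅` minor
(`GridSystem.near_of_adj`, `GridSystem.near_of_walk`).

A `K₅` minor of `A` yields five points in the plane joined by curves such that curves without common
end are disjoint: adjacent faces are joined by a curve crossing their common arc at a point that lies
on only one circle, and at such a point exactly two faces meet (`exists_crossing_point`). Such curves
do not exist (`not_planar_K5`). For a vertex `v` and an edge `kl` avoiding it, let `n v k l` be the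
integer comparing the turn of the vector from the curve `kl` to `v` with fixed arguments
of the differences of the five points. For two independent edges, a continuous logarithm of the
difference of the two curves exists on the whole parameter square, which gives a relation between
four of these integers. Modulo two, every integer occurs in exactly two of the fifteen relations, but
the constant terms add up to the number of crossings of `K₅` in convex position, which is five.
-/

namespace DiskGrid

open scoped Topology

/-! ### Five points of the plane cannot be joined pairwise without independent crossings -/

open Complex in
/-- A nowhere vanishing continuous function on a simply connected space has a continuous
logarithm. -/
lemma exists_continuous_log {A : Type*} [TopologicalSpace A] [SimplyConnectedSpace A]
    [LocallyPathConnectedSpace A] {f : A → ℂ} (hf : Continuous f) (h0 : ∀ a, f a ≠ 0) :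
    ∃ L : A → ℂ, Continuous L ∧ ∀ a, Complex.exp (L a) = f a := by
  obtain ⟨a₀⟩ : Nonempty A := inferInstance
  obtain ⟨L, ⟨-, hL⟩, -⟩ := isCoveringMapOn_exp.existsUnique_continuousMap_lifts
    ⟨f, hf⟩ (a₀ := a₀) (e₀ := Complex.log (f a₀)) (Complex.exp_log (h0 a₀)) (by
      intro a
      simpa using h0 a)
  exact ⟨L, L.continuous, fun a => congrFun hL a⟩

/-- Two continuous logarithms of the same function on the line vary by the same amount. -/
lemma log_variation_eq {L M : ℝ → ℂ} (hL : Continuous L) (hM : Continuous M) {c : ℂ}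
    (h : ∀ t, Complex.exp (L t) = c * Complex.exp (M t)) (a b : ℝ) :
    L b - L a = M b - M a := by
  have hc : c ≠ 0 := by
    rintro rfl
    exact Complex.exp_ne_zero (L 0) (by simpa using h 0)
  have key : ∀ t, ∃ n : ℤ, L t - M t - Complex.log c = n * (2 * Real.pi * Complex.I) := by
    intro t
    rw [← Complex.exp_eq_one_iff, Complex.exp_sub, Complex.exp_sub, Complex.exp_log hc, h t]
    field_simp [Complex.exp_ne_zero]
  choose n hn using key
  -- The integer `n t` is a continuous function of `t`, being the real part below.
  have hcont : Continuous fun t => (n t : ℝ) := by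
    have : (fun t => (n t : ℝ)) =
        fun t => ((L t - M t - Complex.log c) / (2 * Real.pi * Complex.I)).re := by
      funext t
      rw [hn t, mul_div_cancel_right₀ _ Complex.two_pi_I_ne_zero]
      simp
    rw [this]
    fun_prop
  have hcont' : Continuous n := Int.isClosedEmbedding_coe_real.isInducing.continuous_iff.mpr hcont
  have hab : n a = n b := PreconnectedSpace.constant inferInstance hcont'
  have ha := hn a
  have hb := hn b
  rw [hab] at ha
  linear_combination hb - ha

/-- The parity count at the heart of the non-planarity of `K₅`: in the drawing of `K₅` on five
points in convex position an odd number of pairs of independent edges crosses, and every pair of a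
vertex and an edge avoiding it is counted for exactly two pairs of independent edges. -/
lemma parity_contradiction (n : Fin 5 → Fin 5 → Fin 5 → ℤ)
    (h : ∀ i j k l : Fin 5, i < j → k < l → i < k → j ≠ k → j ≠ l →
      n i k l - n j k l - n k i j + n l i j = if k < j ∧ j < l then -1 else 0) : False := by
  have h1 := h 0 1 2 3 (by decide) (by decide) (by decide) (by decide) (by decide)
  have h2 := h 0 1 2 4 (by decide) (by decide) (by decide) (by decide) (by decide)
  have h3 := h 0 1 3 4 (by decide) (by decide) (by decide) (by decide) (by decide)
  have h4 := h 0 2 1 3 (by decide) (by decide) (by decide) (by decide) (by decide)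
  have h5 := h 0 2 1 4 (by decide) (by decide) (by decide) (by decide) (by decide)
  have h6 := h 0 2 3 4 (by decide) (by decide) (by decide) (by decide) (by decide)
  have h7 := h 0 3 1 2 (by decide) (by decide) (by decide) (by decide) (by decide)
  have h8 := h 0 3 1 4 (by decide) (by decide) (by decide) (by decide) (by decide)
  have h9 := h 0 3 2 4 (by decide) (by decide) (by decide) (by decide) (by decide)
  have h10 := h 0 4 1 2 (by decide) (by decide) (by decide) (by decide) (by decide)
  have h11 := h 0 4 1 3 (by decide) (by decide) (by decide) (by decide) (by decide)
  have h12 := h 0 4 2 3 (by decide) (by decide) (by decide) (by decide) (by decide)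
  have h13 := h 1 2 3 4 (by decide) (by decide) (by decide) (by decide) (by decide)
  have h14 := h 1 3 2 4 (by decide) (by decide) (by decide) (by decide) (by decide)
  have h15 := h 1 4 2 3 (by decide) (by decide) (by decide) (by decide) (by decide)
  simp at h1 h2 h3 h4 h5 h6 h7 h8 h9 h10 h11 h12 h13 h14 h15
  omega

/-- `K₅` is not planar, even if edges with a common end are allowed to intersect: among any
curves joining five points of the plane pairwise, two curves with no common end meet. -/
theorem not_planar_K5 (p : Fin 5 → ℂ) (g : Fin 5 → Fin 5 → ℝ → ℂ)
    (hg : ∀ i j, i < j → Continuous (g i j))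
    (hg0 : ∀ i j, i < j → g i j 0 = p i) (hg1 : ∀ i j, i < j → g i j 1 = p j)
    (hdisj : ∀ i j k l, i < j → k < l → i ≠ k → i ≠ l → j ≠ k → j ≠ l →
      ∀ s t, g i j s ≠ g k l t) : False := by
  -- Every vertex `v` outside an edge `kl` lies on an edge independent of `kl`.
  have hfree : ∀ v k l : Fin 5, k < l → v ≠ k → v ≠ l → ∀ t, p v ≠ g k l t := by
    intro v k l hkl hvk hvl t
    obtain ⟨w, hw, hwk, hwl⟩ : ∃ w : Fin 5, w ≠ v ∧ w ≠ k ∧ w ≠ l := by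
      clear * -
      revert v k l
      decide
    rcases lt_or_gt_of_ne hw with hlt | hlt
    · rw [← hg1 w v hlt]
      exact hdisj w v k l hlt hkl hwk hwl hvk hvl 1 t
    · rw [← hg0 v w hlt]
      exact hdisj v w k l hlt hkl hvk hvl hwk hwl 0 t
  have hpne : ∀ i j : Fin 5, i < j → p i - p j ≠ 0 := by
    intro i j hij
    obtain ⟨k, hki, hkj⟩ : ∃ k : Fin 5, k ≠ i ∧ k ≠ j := by
      clear * -
      revert i j
      decide
    rw [sub_ne_zero]
    rcases lt_or_gt_of_ne hkj with hlt | hlt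
    · rw [← hg1 k j hlt]
      exact hfree i k j hlt hki.symm hij.ne 1
    · rw [← hg0 j k hlt]
      exact hfree i j k hlt hij.ne hki.symm 0
  -- `α v a` is an argument of `p v - p a`; the two orders of `v`, `a` differ by half a turn.
  let α : Fin 5 → Fin 5 → ℂ := fun i j =>
    if i < j then Complex.log (p i - p j) else Complex.log (p j - p i) + Real.pi * Complex.I
  have hα : ∀ i j, i ≠ j → Complex.exp (α i j) = p i - p j := by
    intro i j hij
    rcases lt_or_gt_of_ne hij with hlt | hlt
    · simp only [α, if_pos hlt]
      exact Complex.exp_log (hpne i j hlt)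
    · simp only [α, if_neg hlt.not_gt, Complex.exp_add, Complex.exp_pi_mul_I]
      rw [Complex.exp_log (hpne j i hlt)]
      ring
  have hαs : ∀ i j, i < j → α j i = α i j + Real.pi * Complex.I := by
    intro i j hij
    simp only [α, if_pos hij, if_neg hij.not_gt]
  -- `n v k l` compares the turn of the vector from the curve `kl` to `p v` with `α`.
  have hn : ∀ v k l : Fin 5, ∃ n : ℤ, k < l → v ≠ k → v ≠ l →
      ∀ L : ℝ → ℂ, Continuous L → ∀ c : ℂ, (∀ t, Complex.exp (L t) = c * (p v - g k l t)) →
      L 1 - L 0 = α v l - α v k + n * (2 * Real.pi * Complex.I) := by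
    intro v k l
    by_cases hyp : k < l ∧ v ≠ k ∧ v ≠ l
    swap
    · exact ⟨0, fun a b c => absurd ⟨a, b, c⟩ hyp⟩
    obtain ⟨hkl, hvk, hvl⟩ := hyp
    obtain ⟨M, hM, hMe⟩ := exists_continuous_log (f := fun t => p v - g k l t)
      (continuous_const.sub (hg k l hkl)) (fun t => sub_ne_zero.2 (hfree v k l hkl hvk hvl t))
    obtain ⟨n, hn⟩ : ∃ n : ℤ, (M 1 - M 0) - (α v l - α v k) = n * (2 * Real.pi * Complex.I) := by
      rw [← Complex.exp_eq_one_iff, Complex.exp_sub, Complex.exp_sub, Complex.exp_sub,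
        hMe, hMe, hα _ _ hvl, hα _ _ hvk, hg0 k l hkl, hg1 k l hkl]
      have h1 : p v - p k ≠ 0 := by rw [← hα _ _ hvk]; exact Complex.exp_ne_zero _
      have h2 : p v - p l ≠ 0 := by rw [← hα _ _ hvl]; exact Complex.exp_ne_zero _
      field_simp
    refine ⟨n, fun _ _ _ L hL c hLe => ?_⟩
    rw [log_variation_eq hL hM (c := c) (fun t => by rw [hLe, hMe]) 0 1]
    linear_combination hn
  choose n hn using hn
  refine parity_contradiction n fun i j k l hij hkl hik hjk hjl => ?_
  have hil : i < l := hik.trans hkl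
  obtain ⟨L, hL, hLe⟩ := exists_continuous_log (A := ℝ × ℝ)
    (f := fun x => g i j x.1 - g k l x.2)
    (((hg i j hij).comp continuous_fst).sub ((hg k l hkl).comp continuous_snd))
    (fun x => sub_ne_zero.2 (hdisj i j k l hij hkl hik.ne hil.ne hjk hjl _ _))
  -- The total turn along the four sides of the parameter square vanishes.
  have e1 := hn i k l hkl hik.ne hil.ne (fun t => L (0, t)) (by fun_prop) 1 (by
    intro t; rw [hLe, one_mul]; simp only [hg0 i j hij])
  have e2 := hn j k l hkl hjk hjl (fun t => L (1, t)) (by fun_prop) 1 (by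
    intro t; rw [hLe, one_mul]; simp only [hg1 i j hij])
  have e3 := hn k i j hij hik.ne' hjk.symm (fun t => L (t, 0)) (by fun_prop) (-1) (by
    intro t; rw [hLe]; simp only [hg0 k l hkl]; ring)
  have e4 := hn l i j hij hil.ne' hjl.symm (fun t => L (t, 1)) (by fun_prop) (-1) (by
    intro t; rw [hLe]; simp only [hg1 k l hkl]; ring)
  rw [hαs i k hik] at e3
  rw [hαs i l hil] at e4
  have hI := Complex.two_pi_I_ne_zero
  split_ifs with hc
  · rw [hαs k j hc.1] at e2
    rw [hαs j l hc.2] at e4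
    have : ((n i k l - n j k l - n k i j + n l i j + 1 : ℤ) : ℂ) *
        (2 * Real.pi * Complex.I) = 0 := by
      push_cast
      linear_combination e2 + e3 - e1 - e4
    have := (mul_eq_zero.1 this).resolve_right hI
    have : n i k l - n j k l - n k i j + n l i j + 1 = 0 := by exact_mod_cast this
    omega
  · have : ((n i k l - n j k l - n k i j + n l i j : ℤ) : ℂ) * (2 * Real.pi * Complex.I) = 0 := by
      push_cast
      rcases lt_or_gt_of_ne hjk with h1 | h1
      · rw [hαs j k h1] at e3
        rw [hαs j l (h1.trans hkl)] at e4
        linear_combination e2 + e3 - e1 - e4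
      · have h2 : l < j := lt_of_le_of_ne (not_lt.1 fun h => hc ⟨h1, h⟩) hjl.symm
        rw [hαs k j h1, hαs l j h2] at e2
        linear_combination e2 + e3 - e1 - e4
    have := (mul_eq_zero.1 this).resolve_right hI
    exact_mod_cast this

/-! ### Faces of an arrangement of circles -/

section CircleSides

variable {E : Type*} [NormedAddCommGroup E] [InnerProductSpace ℝ E]

/-- Locally at a point `q` of a sphere, the inside of the sphere lies on one side: it contains a
point `z` that sees both `q` and all nearby inside points. -/
lemma exists_inside_point {c q : E} {ρ η : ℝ} (hρ : 0 < ρ) (hη : 0 < η) (hq : dist q c = ρ) :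
    ∃ z : E, segment ℝ z q ⊆ insert q (Metric.ball q η ∩ Metric.ball c ρ) ∧
      z ∈ Metric.ball q η ∩ Metric.ball c ρ ∧
      ∀ᶠ x in 𝓝 q, x ∈ Metric.ball c ρ →
        segment ℝ x z ⊆ Metric.ball q η ∩ Metric.ball c ρ := by
  obtain ⟨θ, hθ0, hθ1, hθη⟩ : ∃ θ : ℝ, 0 < θ ∧ θ < 1 ∧ θ * ρ < η := by
    refine ⟨min (1 / 2) (η / (2 * ρ)), by positivity, ?_, ?_⟩
    · exact (min_le_left _ _).trans_lt (by norm_num)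
    · have : min (1 / 2) (η / (2 * ρ)) * ρ ≤ η / (2 * ρ) * ρ :=
        mul_le_mul_of_nonneg_right (min_le_right _ _) hρ.le
      have h2 : η / (2 * ρ) * ρ = η / 2 := by field_simp
      linarith
  have hn : ‖q - c‖ = ρ := by rw [← dist_eq_norm, hq]
  have hseg : ∀ s : ℝ, 0 < s → s ≤ θ →
      q + s • (c - q) ∈ Metric.ball q η ∩ Metric.ball c ρ := by
    intro s hs hsθ
    constructor
    · rw [Metric.mem_ball, dist_eq_norm, add_sub_cancel_left, norm_smul, Real.norm_of_nonneg hs.le,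
        norm_sub_rev, hn]
      nlinarith
    · rw [Metric.mem_ball, dist_eq_norm]
      have : q + s • (c - q) - c = (1 - s) • (q - c) := by module
      rw [this, norm_smul, hn, Real.norm_of_nonneg (by linarith)]
      nlinarith
  refine ⟨q + θ • (c - q), ?_, hseg θ hθ0 le_rfl, ?_⟩
  · rw [segment_symm, segment_eq_image']
    rintro _ ⟨t, ⟨ht0, ht1⟩, rfl⟩
    rcases ht0.eq_or_lt with rfl | ht
    · left; simp
    · right
      have := hseg (t * θ) (by positivity) (by nlinarith)
      convert this using 1
      module
  · filter_upwards [Metric.ball_mem_nhds q hη] with x hx hxc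
    exact ((convex_ball q η).inter (convex_ball c ρ)).segment_subset ⟨hx, hxc⟩ (hseg θ hθ0 le_rfl)

/-- Locally at a point `q` of a sphere, the outside of the sphere lies on one side: it contains a
point `z` that sees both `q` and all nearby outside points. -/
lemma exists_outside_point {c q : E} {ρ η : ℝ} (hρ : 0 < ρ) (hη : 0 < η) (hq : dist q c = ρ) :
    ∃ z : E, segment ℝ z q ⊆ insert q (Metric.ball q η ∩ (Metric.closedBall c ρ)ᶜ) ∧
      z ∈ Metric.ball q η ∩ (Metric.closedBall c ρ)ᶜ ∧
      ∀ᶠ x in 𝓝 q, x ∈ (Metric.closedBall c ρ)ᶜ →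
        segment ℝ x z ⊆ Metric.ball q η ∩ (Metric.closedBall c ρ)ᶜ := by
  obtain ⟨θ, hθ0, hθη⟩ : ∃ θ : ℝ, 0 < θ ∧ θ * ρ < η := by
    refine ⟨η / (2 * ρ), by positivity, ?_⟩
    have h2 : η / (2 * ρ) * ρ = η / 2 := by field_simp
    linarith
  have hn : ‖q - c‖ = ρ := by rw [← dist_eq_norm, hq]
  have hseg : ∀ s : ℝ, 0 < s → s ≤ θ →
      q + s • (q - c) ∈ Metric.ball q η ∩ (Metric.closedBall c ρ)ᶜ := by
    intro s hs hsθ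
    constructor
    · rw [Metric.mem_ball, dist_eq_norm, add_sub_cancel_left, norm_smul, Real.norm_of_nonneg hs.le,
        hn]
      nlinarith
    · rw [Set.mem_compl_iff, Metric.mem_closedBall, dist_eq_norm, not_le]
      have : q + s • (q - c) - c = (1 + s) • (q - c) := by module
      rw [this, norm_smul, hn, Real.norm_of_nonneg (by linarith)]
      nlinarith
  refine ⟨q + θ • (q - c), ?_, hseg θ hθ0 le_rfl, ?_⟩
  · rw [segment_symm, segment_eq_image']
    rintro _ ⟨t, ⟨ht0, ht1⟩, rfl⟩
    rcases ht0.eq_or_lt with rfl | ht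
    · left; simp
    · right
      have := hseg (t * θ) (by positivity) (by nlinarith)
      convert this using 1
      module
  · -- Near `q` the direction towards `z` points away from the centre, so that the distance to the
    -- centre increases along the segment.
    have hinner : ∀ᶠ x in 𝓝 q, 0 < inner ℝ (q + θ • (q - c) - x) (x - c) := by
      have hcont : Continuous fun x => inner ℝ (q + θ • (q - c) - x) (x - c) := by fun_prop
      apply hcont.continuousAt.eventually_const_lt
      beta_reduce
      rw [add_sub_cancel_left, inner_smul_left, real_inner_self_eq_norm_sq, hn]
      simp only [conj_trivial]
      positivity
    filter_upwards [Metric.ball_mem_nhds q hη, hinner] with x hx hin hxc y hy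
    refine ⟨(convex_ball q η).segment_subset hx (hseg θ hθ0 le_rfl).1 hy, ?_⟩
    rw [segment_eq_image'] at hy
    obtain ⟨t, ⟨ht0, ht1⟩, rfl⟩ := hy
    rw [Set.mem_compl_iff, Metric.mem_closedBall, dist_eq_norm, not_le] at hxc ⊢
    set w := q + θ • (q - c) - x
    have h1 : x + t • w - c = (x - c) + t • w := by abel
    have h2 : ‖x - c‖ ^ 2 ≤ ‖x + t • w - c‖ ^ 2 := by
      rw [h1, norm_add_sq_real, inner_smul_right, real_inner_comm]
      nlinarith [sq_nonneg ‖t • w‖, mul_nonneg ht0 hin.le]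
    exact hxc.trans_le (le_of_sq_le_sq h2 (norm_nonneg _))

end CircleSides

section Faces

variable {V : Type*} {D : V → Disk}

lemma isOpen_offBoundary [Finite V] : IsOpen (offBoundary D) :=
  (isClosed_iUnion_of_finite fun _ => Metric.isClosed_sphere).isOpen_compl

lemma IsFace.subset {F : Set Plane} (hF : IsFace D F) : F ⊆ offBoundary D := by
  obtain ⟨x, -, rfl⟩ := hF
  exact connectedComponentIn_subset _ _

lemma IsFace.isPreconnected {F : Set Plane} (hF : IsFace D F) : IsPreconnected F := by
  obtain ⟨x, -, rfl⟩ := hF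
  exact isPreconnected_connectedComponentIn

lemma IsFace.nonempty {F : Set Plane} (hF : IsFace D F) : F.Nonempty := by
  obtain ⟨x, hx, rfl⟩ := hF
  exact ⟨x, mem_connectedComponentIn hx⟩

lemma IsFace.isOpen [Finite V] {F : Set Plane} (hF : IsFace D F) : IsOpen F := by
  obtain ⟨x, -, rfl⟩ := hF
  exact isOpen_offBoundary.connectedComponentIn

lemma IsFace.eq_component {F : Set Plane} (hF : IsFace D F) {x : Plane} (hx : x ∈ F) :
    F = connectedComponentIn (offBoundary D) x := by
  obtain ⟨y, -, rfl⟩ := hF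
  exact connectedComponentIn_eq hx

lemma IsFace.eq_of_mem {F F' : Set Plane} (hF : IsFace D F) (hF' : IsFace D F') {x : Plane}
    (hx : x ∈ F) (hx' : x ∈ F') : F = F' :=
  (hF.eq_component hx).trans (hF'.eq_component hx').symm

/-- A point of a face is a limit point of no other face. -/
lemma IsFace.eq_of_mem_closure [Finite V] {F F' : Set Plane} (hF : IsFace D F)
    (hF' : IsFace D F') {x : Plane} (hx : x ∈ F) (hx' : x ∈ closure F') : F' = F := by
  obtain ⟨y, hy, hy'⟩ := mem_closure_iff.1 hx' F hF.isOpen hx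
  exact hF'.eq_of_mem hF hy' hy

lemma IsFace.isPathConnected [Finite V] {F : Set Plane} (hF : IsFace D F) : IsPathConnected F :=
  hF.isOpen.isConnected_iff_isPathConnected.1 ⟨hF.nonempty, hF.isPreconnected⟩

/-- At a point of exactly one of the circles, at most two faces meet, and the point can be reached
along a path from each of them. -/
lemma exists_two_sides [Finite V] {q : Plane} {v : V} (hv : q ∈ (D v).boundary)
    (huniq : ∀ u, q ∈ (D u).boundary → u = v) :
    ∃ A B : Set Plane, (∀ F, IsFace D F → q ∈ closure F → F = A ∨ F = B) ∧
      (∃ z ∈ A, JoinedIn (insert q A) z q) ∧ ∃ z ∈ B, JoinedIn (insert q B) z q := by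
  set c := (D v).center
  set ρ := (D v).rad
  have hρ : 0 < ρ := (D v).rad_pos
  have hq : dist q c = ρ := hv
  obtain ⟨η, hη, hball⟩ : ∃ η > 0, ∀ x ∈ Metric.ball q η, ∀ u, x ∈ (D u).boundary → u = v := by
    have hopen : IsOpen (⋃ u : {u : V // u ≠ v}, (D u).boundary)ᶜ :=
      (isClosed_iUnion_of_finite fun _ => Metric.isClosed_sphere).isOpen_compl
    obtain ⟨η, hη, h⟩ := Metric.isOpen_iff.1 hopen q (by
      simp only [Set.mem_compl_iff, Set.mem_iUnion, not_exists]
      exact fun u hu => u.2 (huniq u hu))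
    refine ⟨η, hη, fun x hx u hu => by_contra fun hne => h hx ?_⟩
    exact Set.mem_iUnion.2 ⟨⟨u, hne⟩, hu⟩
  have hoff : ∀ x ∈ Metric.ball q η, dist x c ≠ ρ → x ∈ offBoundary D := by
    intro x hx hne hmem
    obtain ⟨u, hu⟩ := Set.mem_iUnion.1 hmem
    obtain rfl := hball x hx u hu
    exact hne hu
  obtain ⟨z₁, hs₁, hz₁, he₁⟩ := exists_inside_point hρ hη hq
  obtain ⟨z₂, hs₂, hz₂, he₂⟩ := exists_outside_point hρ hη hq
  have hI : Metric.ball q η ∩ Metric.ball c ρ ⊆ offBoundary D :=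
    fun x hx => hoff x hx.1 (ne_of_lt hx.2)
  have hO : Metric.ball q η ∩ (Metric.closedBall c ρ)ᶜ ⊆ offBoundary D :=
    fun x hx => hoff x hx.1 (ne_of_gt (not_le.1 hx.2))
  -- A convex subset of the complement of the circles is contained in the component of its points.
  have hcomp : ∀ x y : Plane, segment ℝ x y ⊆ offBoundary D →
      x ∈ connectedComponentIn (offBoundary D) y := fun x y h =>
    (convex_segment x y).isPreconnected.subset_connectedComponentIn (right_mem_segment ℝ x y) h
      (left_mem_segment ℝ x y)
  have hjoin : ∀ z : Plane, z ∈ offBoundary D → segment ℝ z q ⊆ insert q (offBoundary D) →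
      JoinedIn (insert q (connectedComponentIn (offBoundary D) z)) z q := by
    intro z hz hs
    refine JoinedIn.of_segment_subset fun y hy => ?_
    by_cases hyq : y = q
    · exact Or.inl hyq
    · refine Or.inr (hcomp y z ?_)
      intro x hx
      have hxs : x ∈ segment ℝ z q := (convex_segment z q).segment_subset hy
        (left_mem_segment ℝ z q) hx
      refine (hs hxs).resolve_left ?_
      rintro rfl
      -- `q` lies outside the segment between `y` and `z`, both being on the same side of it.
      rw [segment_symm, segment_eq_image'] at hy
      rw [segment_eq_image'] at hx
      obtain ⟨t, ⟨ht0, ht1⟩, rfl⟩ := hy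
      obtain ⟨s, ⟨hs0, hs1⟩, hst⟩ := hx
      have hzx : z ≠ x := by
        rintro rfl
        exact hyq (by simp)
      have h3 : (t + s * (1 - t)) • (z - x) = 0 := by
        have : x + t • (z - x) + s • (z - (x + t • (z - x))) - x =
            (t + s * (1 - t)) • (z - x) := by module
        rw [← this, sub_eq_zero]
        exact hst
      rcases smul_eq_zero.1 h3 with h4 | h4
      · have ht : t = 0 := by nlinarith
        exact hyq (by simp [ht])
      · exact hzx (sub_eq_zero.1 h4)
  refine ⟨connectedComponentIn (offBoundary D) z₁, connectedComponentIn (offBoundary D) z₂,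
    ?_, ⟨z₁, mem_connectedComponentIn (hI hz₁), hjoin z₁ (hI hz₁) ?_⟩,
    ⟨z₂, mem_connectedComponentIn (hO hz₂), hjoin z₂ (hO hz₂) ?_⟩⟩
  · intro F hF hqF
    obtain ⟨x, ⟨hx₁, hx₂⟩, hxF⟩ := mem_closure_iff_nhds.1 hqF _ (he₁.and he₂)
    have hxη : dist x c ≠ ρ := by
      intro h
      exact hF.subset hxF (Set.mem_iUnion.2 ⟨v, h⟩)
    rcases lt_or_gt_of_ne hxη with h | h
    · left
      rw [hF.eq_component hxF]
      exact (connectedComponentIn_eq (hcomp x z₁ ((hx₁ h).trans hI))).symm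
    · right
      rw [hF.eq_component hxF]
      exact (connectedComponentIn_eq (hcomp x z₂ ((hx₂ (not_le.2 h)).trans hO))).symm
  · exact hs₁.trans (Set.insert_subset_insert hI)
  · exact hs₂.trans (Set.insert_subset_insert hO)

/-- Two different circles have finitely many common points. -/
lemma finite_boundary_inter (hD : InGeneralPosition D) {u v : V} (huv : u ≠ v) :
    ((D u).boundary ∩ (D v).boundary).Finite := by
  by_cases hc : (D u).center = (D v).center
  · have hr : (D u).rad ≠ (D v).rad := fun hr => hD.ne_of_ne u v huv (by
      simp only [Disk.carrier, hc, hr])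
    convert Set.finite_empty
    rw [Set.eq_empty_iff_forall_notMem]
    rintro x ⟨hx, hx'⟩
    simp only [Disk.boundary, Metric.mem_sphere] at hx hx'
    exact hr (by rw [← hx, ← hx', hc])
  · by_cases hs : ((D u).boundary ∩ (D v).boundary).Subsingleton
    · exact hs.finite
    · rw [Set.not_subsingleton_iff] at hs
      obtain ⟨p₁, h₁, p₂, h₂, hne⟩ := hs
      refine (Set.toFinite {p₁, p₂}).subset fun p hp => ?_
      exact EuclideanGeometry.eq_of_dist_eq_of_dist_eq_of_finrank_eq_two (by simp) hc hne
        h₁.1 h₂.1 hp.1 h₁.2 h₂.2 hp.2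

/-- Adjacent faces have a common boundary point that is in the closure of no third face and
that can be reached along a path from each of the two. -/
lemma exists_crossing_point [Finite V] (hD : InGeneralPosition D) {F F' : CoveredFace D}
    (h : (arrangementGraph D).Adj F F') :
    ∃ q : Plane, q ∈ closure F.1 ∧ q ∈ closure F'.1 ∧
      (∀ A, IsFace D A → q ∈ closure A → A = F.1 ∨ A = F'.1) ∧
      (∃ z ∈ F.1, JoinedIn (insert q F.1) z q) ∧ ∃ z ∈ F'.1, JoinedIn (insert q F'.1) z q := by
  obtain ⟨hne, a, ha, hconn, hnt⟩ := h
  have hne' : F.1 ≠ F'.1 := fun h => hne (Subtype.ext h)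
  -- The arc is infinite, but only finitely many points are on two circles.
  have hfin : (⋃ p : {p : V × V // p.1 ≠ p.2}, (D p.1.1).boundary ∩ (D p.1.2).boundary).Finite :=
    Set.finite_iUnion fun p => finite_boundary_inter hD p.2
  obtain ⟨q, hqa, hq⟩ :=
    ((hconn.isPreconnected.infinite_of_nontrivial hnt).sdiff hfin).nonempty
  have hqF := frontier_subset_closure (ha hqa).1
  have hqF' := frontier_subset_closure (ha hqa).2
  have hmem : q ∈ ⋃ v, (D v).boundary := by
    by_contra hoff
    have hface : IsFace D (connectedComponentIn (offBoundary D) q) := ⟨q, hoff, rfl⟩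
    have hq' := mem_connectedComponentIn (F := offBoundary D) hoff
    exact hne' ((hface.eq_of_mem_closure F.2.1 hq' hqF).trans
      (hface.eq_of_mem_closure F'.2.1 hq' hqF').symm)
  obtain ⟨v, hv⟩ := Set.mem_iUnion.1 hmem
  obtain ⟨A, B, hAB, hA, hB⟩ := exists_two_sides hv (fun u hu => by_contra fun huv =>
    hq (Set.mem_iUnion.2 ⟨⟨(u, v), huv⟩, hu, hv⟩))
  refine ⟨q, hqF, hqF', ?_⟩
  rcases hAB _ F.2.1 hqF with h1 | h1 <;> rcases hAB _ F'.2.1 hqF' with h2 | h2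
  · exact absurd (h1.trans h2.symm) hne'
  · rw [h1, h2]
    exact ⟨hAB, hA, hB⟩
  · rw [h1, h2]
    exact ⟨fun A hA hqA => (hAB A hA hqA).symm, hB, hA⟩
  · exact absurd (h1.trans h2.symm) hne'

/-- The part of the plane belonging to a set `S` of faces: the points that are in the closure of
some face of `S` and of no face outside `S`. -/
def region (D : V → Disk) (S : Set (CoveredFace D)) : Set Plane :=
  {x | (∃ F ∈ S, x ∈ closure F.1) ∧ ∀ A, IsFace D A → x ∈ closure A → ∃ F ∈ S, F.1 = A}

lemma region_mono {S T : Set (CoveredFace D)} (h : S ⊆ T) : region D S ⊆ region D T := by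
  rintro x ⟨⟨F, hF, hx⟩, hA⟩
  refine ⟨⟨F, h hF, hx⟩, fun A hAf hxA => ?_⟩
  obtain ⟨F', hF', rfl⟩ := hA A hAf hxA
  exact ⟨F', h hF', rfl⟩

lemma disjoint_region {S T : Set (CoveredFace D)} (h : Disjoint S T) :
    Disjoint (region D S) (region D T) := by
  rw [Set.disjoint_left]
  rintro x ⟨⟨F, hF, hx⟩, -⟩ ⟨-, hT⟩
  obtain ⟨F', hF', he⟩ := hT F.1 F.2.1 hx
  exact Set.disjoint_left.1 h hF (Subtype.ext he ▸ hF')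

lemma subset_region [Finite V] {S : Set (CoveredFace D)} {F : CoveredFace D} (hF : F ∈ S) :
    F.1 ⊆ region D S := fun _ hx =>
  ⟨⟨F, hF, subset_closure hx⟩, fun _ hA hxA => ⟨F, hF, (F.2.1.eq_of_mem_closure hA hx hxA).symm⟩⟩

lemma joinedIn_region_of_mem [Finite V] {S : Set (CoveredFace D)} {F : CoveredFace D} (hF : F ∈ S)
    {x y : Plane} (hx : x ∈ F.1) (hy : y ∈ F.1) : JoinedIn (region D S) x y :=
  (F.2.1.isPathConnected.joinedIn x hx y hy).mono (subset_region hF)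

lemma joinedIn_region_of_adj [Finite V] (hD : InGeneralPosition D) {S : Set (CoveredFace D)}
    {F F' : CoveredFace D} (hF : F ∈ S) (hF' : F' ∈ S) (h : (arrangementGraph D).Adj F F')
    {x y : Plane} (hx : x ∈ F.1) (hy : y ∈ F'.1) : JoinedIn (region D S) x y := by
  obtain ⟨q, hq, hq', hA, ⟨z, hz, hzq⟩, z', hz', hzq'⟩ := exists_crossing_point hD h
  have hqS : q ∈ region D S := by
    refine ⟨⟨F, hF, hq⟩, fun A hAf hqA => ?_⟩
    rcases hA A hAf hqA with rfl | rfl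
    · exact ⟨F, hF, rfl⟩
    · exact ⟨F', hF', rfl⟩
  have h1 := hzq.mono (Set.insert_subset hqS (subset_region hF))
  have h2 := hzq'.mono (Set.insert_subset hqS (subset_region hF'))
  exact (joinedIn_region_of_mem hF hx hz).trans
    (h1.trans (h2.symm.trans (joinedIn_region_of_mem hF' hz' hy)))

lemma joinedIn_region_of_connected [Finite V] (hD : InGeneralPosition D)
    {S : Set (CoveredFace D)} (hS : ((arrangementGraph D).induce S).Connected)
    {F F' : CoveredFace D} (hF : F ∈ S) (hF' : F' ∈ S) {x y : Plane} (hx : x ∈ F.1)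
    (hy : y ∈ F'.1) : JoinedIn (region D S) x y := by
  have h := (SimpleGraph.reachable_iff_reflTransGen _ _).1 (hS.preconnected ⟨F, hF⟩ ⟨F', hF'⟩)
  have key : ∀ G : S, Relation.ReflTransGen ((arrangementGraph D).induce S).Adj ⟨F, hF⟩ G →
      ∀ y ∈ G.1.1, JoinedIn (region D S) x y := by
    intro G hG
    induction hG with
    | refl => exact fun y hy => joinedIn_region_of_mem hF hx hy
    | @tail G G' _ hadj ih =>
      intro y hy
      obtain ⟨z, hz⟩ := G.1.2.1.nonempty
      exact (ih z hz).trans (joinedIn_region_of_adj hD G.2 G'.2 hadj hz hy)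
  exact key _ h y hy

/-- A drawing of a `K₅` minor inside the regions of its branch sets contradicts `not_planar_K5`. -/
theorem not_isMinor_K5_arrangementGraph [Finite V] (hD : InGeneralPosition D) :
    ¬ IsMinor (⊤ : SimpleGraph (Fin 5)) (arrangementGraph D) := by
  rintro ⟨φ, hφ, hdisj, hadj⟩
  have hF : ∀ i, ∃ F : CoveredFace D, F ∈ φ i := fun i =>
    let ⟨F⟩ := (hφ i).nonempty
    ⟨F.1, F.2⟩
  choose F hF using hF
  choose p hp using fun i => (F i).2.1.nonempty
  have hjoin : ∀ i j, i < j → JoinedIn (region D (φ i ∪ φ j)) (p i) (p j) := by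
    intro i j hij
    obtain ⟨a, ha, b, hb, hab⟩ := hadj i j hij.ne
    obtain ⟨x, hx⟩ := a.2.1.nonempty
    obtain ⟨y, hy⟩ := b.2.1.nonempty
    exact ((joinedIn_region_of_connected hD (hφ i) (hF i) ha (hp i) hx).mono
      (region_mono Set.subset_union_left)).trans
      ((joinedIn_region_of_adj hD (Or.inl ha) (Or.inr hb) hab hx hy).trans
      ((joinedIn_region_of_connected hD (hφ j) hb (hF j) hy (hp j)).mono
      (region_mono Set.subset_union_right)))
  let toC : Plane → ℂ := fun x => Complex.equivRealProdCLM.symm (x 0, x 1)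
  have hcont : Continuous toC := by fun_prop
  have hinj : Function.Injective toC := by
    intro x y hxy
    have := Complex.equivRealProdCLM.symm.injective hxy
    ext i
    fin_cases i
    · exact (Prod.ext_iff.1 this).1
    · exact (Prod.ext_iff.1 this).2
  let g : Fin 5 → Fin 5 → ℝ → Plane := fun i j =>
    if h : i < j then (hjoin i j h).somePath.extend else fun _ => p i
  have hmem : ∀ i j, i < j → ∀ t, g i j t ∈ region D (φ i ∪ φ j) := by
    intro i j hij t
    simp only [g, dif_pos hij]
    exact (hjoin i j hij).somePath_mem _
  refine not_planar_K5 (fun i => toC (p i)) (fun i j t => toC (g i j t)) ?_ ?_ ?_ ?_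
  · intro i j hij
    simp only [g, dif_pos hij]
    exact hcont.comp (Path.continuous_extend _)
  · intro i j hij
    simp [g, dif_pos hij]
  · intro i j hij
    simp [g, dif_pos hij]
  · intro i j k l hij hkl hik hil hjk hjl s t hst
    refine Set.disjoint_left.1 (disjoint_region ?_) (hmem i j hij s) (hinj hst ▸ hmem k l hkl t)
    rw [Set.disjoint_union_left, Set.disjoint_union_right, Set.disjoint_union_right]
    exact ⟨⟨hdisj _ _ hik, hdisj _ _ hil⟩, hdisj _ _ hjk, hdisj _ _ hjl⟩

end Faces

/-! ### Connected vertex sets placed along a grid -/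

section Linked

variable {U : Type*} {G : SimpleGraph U}

/-- The vertices `x` and `y` are joined by a walk of `G` inside the vertex set `S`. -/
def Linked (G : SimpleGraph U) (S : Set U) (x y : U) : Prop :=
  x ∈ S ∧ Relation.ReflTransGen (fun a b => G.Adj a b ∧ a ∈ S ∧ b ∈ S) x y

lemma Linked.refl {S : Set U} {x : U} (hx : x ∈ S) : Linked G S x x := ⟨hx, .refl⟩

lemma Linked.mem_right {S : Set U} {x y : U} (h : Linked G S x y) : y ∈ S := by
  rcases h.2.cases_tail with rfl | ⟨z, -, -, -, hy⟩
  exacts [h.1, hy]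

lemma Linked.symm {S : Set U} {x y : U} (h : Linked G S x y) : Linked G S y x :=
  have : Std.Symm fun a b => G.Adj a b ∧ a ∈ S ∧ b ∈ S := ⟨fun _ _ h => ⟨h.1.symm, h.2.2, h.2.1⟩⟩
  ⟨h.mem_right, Relation.ReflTransGen.stdSymm.symm _ _ h.2⟩

lemma Linked.trans {S : Set U} {x y z : U} (h : Linked G S x y) (h' : Linked G S y z) :
    Linked G S x z := ⟨h.1, h.2.trans h'.2⟩

lemma Linked.mono {S T : Set U} (hST : S ⊆ T) {x y : U} (h : Linked G S x y) :
    Linked G T x y :=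
  ⟨hST h.1, Relation.ReflTransGen.mono (fun _ _ h => ⟨h.1, hST h.2.1, hST h.2.2⟩) _ _ h.2⟩

lemma Linked.of_adj {S : Set U} {x y : U} (h : G.Adj x y) (hx : x ∈ S) (hy : y ∈ S) :
    Linked G S x y := ⟨hx, .single ⟨h, hx, hy⟩⟩

/-- A walk inside `S` stays inside the component of its start. -/
lemma Linked.restrict {S : Set U} {x y : U} (h : Linked G S x y) :
    Linked G {z | Linked G S x z} x y := by
  have hx : x ∈ {z | Linked G S x z} := Linked.refl h.1
  obtain ⟨hxS, h⟩ := h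
  induction h with
  | refl => exact .refl hx
  | tail h1 h2 ih =>
    exact ih.trans (Linked.of_adj h2.1 ⟨hxS, h1⟩ ⟨hxS, h1.tail h2⟩)

lemma connected_induce_iff {S : Set U} :
    (G.induce S).Connected ↔ S.Nonempty ∧ ∀ x ∈ S, ∀ y ∈ S, Linked G S x y := by
  constructor
  · intro h
    obtain ⟨x⟩ := h.nonempty
    refine ⟨⟨x.1, x.2⟩, fun x hx y hy => ⟨hx, ?_⟩⟩
    have := (SimpleGraph.reachable_iff_reflTransGen _ _).1 (h.preconnected ⟨x, hx⟩ ⟨y, hy⟩)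
    exact this.lift Subtype.val fun a b hab => ⟨hab, a.2, b.2⟩
  · rintro ⟨⟨x, hx⟩, h⟩
    have key : ∀ y (hy : y ∈ S), (G.induce S).Reachable ⟨x, hx⟩ ⟨y, hy⟩ := by
      intro y hy
      have hl := (h x hx y hy).2
      clear h
      induction hl with
      | refl => exact SimpleGraph.Reachable.rfl
      | @tail b c _ hbc ih =>
        have hadj : (G.induce S).Adj ⟨b, hbc.2.1⟩ ⟨c, hy⟩ := hbc.1
        exact (ih hbc.2.1).trans hadj.reachable
    have : Nonempty S := ⟨⟨x, hx⟩⟩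
    exact ⟨fun a b => (key a.1 a.2).symm.trans (key b.1 b.2)⟩

lemma linked_of_connected {S : Set U} (h : (G.induce S).Connected) {x y : U} (hx : x ∈ S)
    (hy : y ∈ S) : Linked G S x y :=
  (connected_induce_iff.1 h).2 x hx y hy

lemma nonempty_of_connected {S : Set U} (h : (G.induce S).Connected) : S.Nonempty :=
  (connected_induce_iff.1 h).1

/-- It suffices to link all vertices to vertices of a linked core. -/
lemma connected_of_core {Q S : Set U} (hQ : (G.induce Q).Connected) (hQS : Q ⊆ S)
    (h : ∀ x ∈ S, ∃ a ∈ Q, Linked G S a x) : (G.induce S).Connected := by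
  refine connected_induce_iff.2 ⟨(nonempty_of_connected hQ).mono hQS, fun x hx y hy => ?_⟩
  obtain ⟨a, ha, hax⟩ := h x hx
  obtain ⟨b, hb, hby⟩ := h y hy
  exact hax.symm.trans (((linked_of_connected hQ ha hb).mono hQS).trans hby)

/-- Two vertex sets touch if they have a common vertex or are joined by an edge. -/
def Touch (G : SimpleGraph U) (S T : Set U) : Prop := ∃ a ∈ S, ∃ b ∈ T, a = b ∨ G.Adj a b

lemma Touch.symm {S T : Set U} (h : Touch G S T) : Touch G T S := by
  obtain ⟨a, ha, b, hb, h⟩ := h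
  exact ⟨b, hb, a, ha, h.imp Eq.symm SimpleGraph.Adj.symm⟩

lemma Touch.mono {S S' T T' : Set U} (h : Touch G S T) (hS : S ⊆ S') (hT : T ⊆ T') :
    Touch G S' T' := by
  obtain ⟨a, ha, b, hb, h⟩ := h
  exact ⟨a, hS ha, b, hT hb, h⟩

lemma linked_union_of_touch {S T : Set U} (hS : (G.induce S).Connected)
    (hT : (G.induce T).Connected) (h : Touch G S T) {x y : U} (hx : x ∈ S) (hy : y ∈ T) :
    Linked G (S ∪ T) x y := by
  obtain ⟨a, ha, b, hb, hab⟩ := h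
  have h1 := (linked_of_connected hS hx ha).mono (Set.subset_union_left (t := T))
  have h2 := (linked_of_connected hT hb hy).mono (Set.subset_union_right (s := S))
  rcases hab with rfl | hab
  · exact h1.trans h2
  · exact h1.trans ((Linked.of_adj hab (Or.inl ha) (Or.inr hb)).trans h2)

lemma connected_union {S T : Set U} (hS : (G.induce S).Connected)
    (hT : (G.induce T).Connected) (h : Touch G S T) : (G.induce (S ∪ T)).Connected := by
  obtain ⟨a, ha⟩ := nonempty_of_connected hS
  refine connected_of_core hS Set.subset_union_left ?_
  rintro x (hx | hx)
  · exact ⟨x, hx, .refl (Or.inl hx)⟩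
  · exact ⟨a, ha, linked_union_of_touch hS hT h ha hx⟩

/-- A union of connected sets is connected if the indices are chained by touching sets. -/
lemma connected_biUnion {ι : Type*} {T : Set ι} {S : ι → Set U}
    (hS : ∀ i ∈ T, (G.induce (S i)).Connected) {i₀ : ι} (h₀ : i₀ ∈ T)
    (h : ∀ i ∈ T, Relation.ReflTransGen
      (fun i j => i ∈ T ∧ j ∈ T ∧ Touch G (S i) (S j)) i₀ i) :
    (G.induce (⋃ i ∈ T, S i)).Connected := by
  obtain ⟨a, ha⟩ := nonempty_of_connected (hS i₀ h₀)
  refine connected_of_core (hS i₀ h₀) (Set.subset_biUnion_of_mem h₀) fun x hx => ⟨a, ha, ?_⟩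
  obtain ⟨i, hi, hxi⟩ := Set.mem_iUnion₂.1 hx
  have hl := h i hi
  clear hx
  induction hl generalizing x with
  | refl => exact (linked_of_connected (hS i₀ h₀) ha hxi).mono (Set.subset_biUnion_of_mem h₀)
  | @tail j k _ hjk ih =>
    obtain ⟨hj, hk, ht⟩ := hjk
    obtain ⟨b, hb⟩ := nonempty_of_connected (hS j hj)
    exact (ih b hj hb).trans ((linked_union_of_touch (hS j hj) (hS k hk) ht hb hxi).mono
      (Set.union_subset (Set.subset_biUnion_of_mem hj) (Set.subset_biUnion_of_mem hk)))

end Linked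

section Systems

variable {U : Type*} {G : SimpleGraph U} {n : ℤ} {S : ℤ × ℤ → Set U}

/-- The positions of the `n × n` grid, embedded in the integer lattice. -/
def InBox (n : ℤ) (w : ℤ × ℤ) : Prop := 0 ≤ w.1 ∧ w.1 < n ∧ 0 ≤ w.2 ∧ w.2 < n

/-- Connected vertex sets of `G` placed at the positions of the `n × n` grid such that sets at
neighbouring positions touch. The sets need not be disjoint. -/
structure GridSystem (G : SimpleGraph U) (n : ℤ) (S : ℤ × ℤ → Set U) : Prop where
  conn : ∀ w, InBox n w → (G.induce (S w)).Connected
  right : ∀ i j, InBox n (i, j) → InBox n (i + 1, j) → Touch G (S (i, j)) (S (i + 1, j))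
  up : ∀ i j, InBox n (i, j) → InBox n (i, j + 1) → Touch G (S (i, j)) (S (i, j + 1))

lemma InBox.of_mem_Icc {p q w : ℤ × ℤ} (hp : InBox n p) (hq : InBox n q) (hw : w ∈ Set.Icc p q) :
    InBox n w := by
  obtain ⟨h1, h2, h3, h4⟩ := hp
  obtain ⟨h5, h6, h7, h8⟩ := hq
  obtain ⟨⟨h9, h10⟩, h11, h12⟩ := hw
  exact ⟨by omega, by omega, by omega, by omega⟩

lemma GridSystem.connected_rectangle (h : GridSystem G n S) {p q : ℤ × ℤ} (hp : InBox n p)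
    (hq : InBox n q) (hpq : p ≤ q) : (G.induce (⋃ w ∈ Set.Icc p q, S w)).Connected := by
  have hbox : ∀ w ∈ Set.Icc p q, InBox n w := fun w hw => hp.of_mem_Icc hq hw
  refine connected_biUnion (fun w hw => h.conn w (hbox w hw)) (Set.left_mem_Icc.2 hpq) ?_
  obtain ⟨a, b⟩ := p
  obtain ⟨c, d⟩ := q
  rintro ⟨x, y⟩ ⟨⟨hx, hy⟩, hx', hy'⟩
  simp only at hx hy hx' hy'
  have hmem : ∀ x y, a ≤ x → b ≤ y → x ≤ c → y ≤ d → (x, y) ∈ Set.Icc (a, b) (c, d) :=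
    fun x y h1 h2 h3 h4 => ⟨⟨h1, h2⟩, h3, h4⟩
  have hrow : Relation.ReflTransGen (fun i j => i ∈ Set.Icc (a, b) (c, d) ∧
      j ∈ Set.Icc (a, b) (c, d) ∧ Touch G (S i) (S j)) (a, b) (x, b) := by
    induction x, hx using Int.leInduction with
    | base => exact .refl
    | succ x hx ih =>
      have m1 := hmem x b hx le_rfl (by omega) (by omega)
      have m2 := hmem (x + 1) b (by omega) le_rfl (by omega) (by omega)
      exact (ih (by omega)).tail ⟨m1, m2, h.right x b (hbox _ m1) (hbox _ m2)⟩
  induction y, hy using Int.leInduction with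
  | base => exact hrow
  | succ y hy ih =>
    have m1 := hmem x y hx hy (by omega) (by omega)
    have m2 := hmem x (y + 1) hx (by omega) (by omega) (by omega)
    exact (ih (by omega)).tail ⟨m1, m2, h.up x y (hbox _ m1) (hbox _ m2)⟩

lemma isMinor_K5 {B₀ B₁ B₂ B₃ B₄ : Set U}
    (c₀ : (G.induce B₀).Connected) (c₁ : (G.induce B₁).Connected) (c₂ : (G.induce B₂).Connected)
    (c₃ : (G.induce B₃).Connected) (c₄ : (G.induce B₄).Connected)
    (d₀₁ : Disjoint B₀ B₁) (d₀₂ : Disjoint B₀ B₂) (d₀₃ : Disjoint B₀ B₃) (d₀₄ : Disjoint B₀ B₄)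
    (d₁₂ : Disjoint B₁ B₂) (d₁₃ : Disjoint B₁ B₃) (d₁₄ : Disjoint B₁ B₄)
    (d₂₃ : Disjoint B₂ B₃) (d₂₄ : Disjoint B₂ B₄) (d₃₄ : Disjoint B₃ B₄)
    (t₀₁ : Touch G B₀ B₁) (t₀₂ : Touch G B₀ B₂) (t₀₃ : Touch G B₀ B₃) (t₀₄ : Touch G B₀ B₄)
    (t₁₂ : Touch G B₁ B₂) (t₁₃ : Touch G B₁ B₃) (t₁₄ : Touch G B₁ B₄)
    (t₂₃ : Touch G B₂ B₃) (t₂₄ : Touch G B₂ B₄) (t₃₄ : Touch G B₃ B₄) :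
    IsMinor (⊤ : SimpleGraph (Fin 5)) G := by
  let B : Fin 5 → Set U := ![B₀, B₁, B₂, B₃, B₄]
  have hc : ∀ i, (G.induce (B i)).Connected := by
    intro i
    fin_cases i
    exacts [c₀, c₁, c₂, c₃, c₄]
  have hlt : ∀ i j, i < j → Disjoint (B i) (B j) ∧ Touch G (B i) (B j) := by
    intro i j hij
    fin_cases i <;> fin_cases j <;> first
      | exact absurd hij (by decide)
      | exact ⟨‹_›, ‹_›⟩
  have hne : ∀ i j, i ≠ j → Disjoint (B i) (B j) ∧ Touch G (B i) (B j) := by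
    intro i j hij
    rcases lt_or_gt_of_ne hij with h | h
    · exact hlt i j h
    · exact ⟨(hlt j i h).1.symm, (hlt j i h).2.symm⟩
  refine ⟨B, hc, fun i j hij => (hne i j hij).1, fun i j hij => ?_⟩
  obtain ⟨hd, a, ha, b, hb, rfl | h⟩ := hne i j hij
  · exact absurd hb (Set.disjoint_left.1 hd ha)
  · exact ⟨a, ha, b, hb, h⟩

/-- In a graph without `K₅` minor, a connected enlargement of a branch set of a grid minor that
avoids all other branch sets is adjacent only to branch sets of the eight surrounding positions,
unless the position is near the border of the grid. Otherwise the ring of the eight surrounding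
positions, cut into three arcs, the position itself, and the rest of the grid would form
a `K₅` minor. -/
lemma GridSystem.near_of_adj (h : GridSystem G n S) (hK : ¬ IsMinor (⊤ : SimpleGraph (Fin 5)) G)
    (hdisj : ∀ w w', w ≠ w' → Disjoint (S w) (S w')) {w w' : ℤ × ℤ}
    (hw : 2 ≤ w.1 ∧ w.1 + 2 < n ∧ 2 ≤ w.2 ∧ w.2 + 2 < n) (hw' : InBox n w')
    {C : Set U} (hC : (G.induce C).Connected) (hSC : S w ⊆ C)
    (hCd : ∀ v, v ≠ w → Disjoint C (S v)) {c y : U} (hc : c ∈ C) (hy : y ∈ S w')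
    (hcy : G.Adj c y) :
    |w.1 - w'.1| ≤ 1 ∧ |w.2 - w'.2| ≤ 1 := by
  by_contra hfar
  refine hK ?_
  obtain ⟨a, b⟩ := w
  obtain ⟨a', b'⟩ := w'
  obtain ⟨h1, h2, h3, h4⟩ := hw
  obtain ⟨k1, k2, k3, k4⟩ := hw'
  simp only at h1 h2 h3 h4 k1 k2 k3 k4 hfar
  rw [abs_le, abs_le] at hfar
  let SS : Set (ℤ × ℤ) → Set U := fun R => ⋃ w ∈ R, S w
  have hrect : ∀ x y x' y' : ℤ, 0 ≤ x → 0 ≤ y → x ≤ x' → y ≤ y' → x' < n → y' < n →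
      (G.induce (SS (Set.Icc (x, y) (x', y')))).Connected := fun x y x' y' _ _ _ _ _ _ =>
    h.connected_rectangle ⟨by simp only; omega, by simp only; omega, by simp only; omega,
      by simp only; omega⟩ ⟨by simp only; omega, by simp only; omega, by simp only; omega,
      by simp only; omega⟩ ⟨by simp only; omega, by simp only; omega⟩
  have hsub : ∀ R, ∀ w ∈ R, S w ⊆ SS R := fun R w hw => Set.subset_biUnion_of_mem hw
  have hunion : ∀ R R', (G.induce (SS R)).Connected → (G.induce (SS R')).Connected →
      ∀ w, InBox n w → w ∈ R → w ∈ R' → (G.induce (SS (R ∪ R'))).Connected := by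
    intro R R' hR hR' w hwn hw hw'
    have hSS : SS (R ∪ R') = SS R ∪ SS R' := Set.biUnion_union _ _ _
    rw [hSS]
    obtain ⟨x, hx⟩ := nonempty_of_connected (h.conn w hwn)
    exact connected_union hR hR' ⟨x, hsub R w hw hx, x, hsub R' w hw' hx, Or.inl rfl⟩
  have hSd : ∀ R R' : Set (ℤ × ℤ), (∀ w ∈ R, w ∉ R') → Disjoint (SS R) (SS R') := by
    intro R R' hRR'
    simp only [SS, Set.disjoint_iUnion_left, Set.disjoint_iUnion_right]
    exact fun w' hw' w hw => hdisj _ _ fun e => hRR' w hw (e ▸ hw')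
  have hCS : ∀ R : Set (ℤ × ℤ), (a, b) ∉ R → Disjoint C (SS R) := by
    intro R hR
    simp only [SS, Set.disjoint_iUnion_right]
    exact fun w hw => hCd w fun e => hR (e ▸ hw)
  have hright : ∀ (R R' : Set (ℤ × ℤ)) (x y : ℤ), (x, y) ∈ R → (x + 1, y) ∈ R' → 0 ≤ x → 0 ≤ y →
      x + 1 < n → y < n → Touch G (SS R) (SS R') := fun R R' x y hR hR' _ _ _ _ =>
    (h.right x y ⟨by simp only; omega, by simp only; omega, by simp only; omega,
      by simp only; omega⟩ ⟨by simp only; omega, by simp only; omega, by simp only; omega,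
      by simp only; omega⟩).mono (hsub R _ hR) (hsub R' _ hR')
  have hup : ∀ (R R' : Set (ℤ × ℤ)) (x y : ℤ), (x, y) ∈ R → (x, y + 1) ∈ R' → 0 ≤ x → 0 ≤ y →
      x < n → y + 1 < n → Touch G (SS R) (SS R') := fun R R' x y hR hR' _ _ _ _ =>
    (h.up x y ⟨by simp only; omega, by simp only; omega, by simp only; omega,
      by simp only; omega⟩ ⟨by simp only; omega, by simp only; omega, by simp only; omega,
      by simp only; omega⟩).mono (hsub R _ hR) (hsub R' _ hR')
  have hSC' : SS {(a, b)} ⊆ C := by simpa [SS] using hSC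
  -- `T`, `W`, `E` are the arcs of the ring, its top row, its left side and the remaining corner;
  -- `O` is the part of the grid outside the ring.
  let T : Set (ℤ × ℤ) := Set.Icc (a - 1, b + 1) (a + 1, b + 1)
  let W : Set (ℤ × ℤ) := Set.Icc (a - 1, b - 1) (a - 1, b)
  let E : Set (ℤ × ℤ) := Set.Icc (a, b - 1) (a + 1, b - 1) ∪ Set.Icc (a + 1, b - 1) (a + 1, b)
  let O : Set (ℤ × ℤ) := ((Set.Icc (0, 0) (a - 2, n - 1) ∪ Set.Icc (0, 0) (n - 1, b - 2)) ∪
    Set.Icc (a + 2, 0) (n - 1, n - 1)) ∪ Set.Icc (0, b + 2) (n - 1, n - 1)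
  have mT : ∀ x y, (x, y) ∈ T ↔ a - 1 ≤ x ∧ x ≤ a + 1 ∧ y = b + 1 := by
    intro x y; simp only [T, Set.mem_Icc, Prod.mk_le_mk]; omega
  have mW : ∀ x y, (x, y) ∈ W ↔ x = a - 1 ∧ b - 1 ≤ y ∧ y ≤ b := by
    intro x y; simp only [W, Set.mem_Icc, Prod.mk_le_mk]; omega
  have mE : ∀ x y, (x, y) ∈ E ↔ (a ≤ x ∧ x ≤ a + 1 ∧ y = b - 1) ∨
      (x = a + 1 ∧ b - 1 ≤ y ∧ y ≤ b) := by
    intro x y; simp only [E, Set.mem_union, Set.mem_Icc, Prod.mk_le_mk]; omega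
  have mO : ∀ x y, (x, y) ∈ O ↔ (0 ≤ x ∧ 0 ≤ y ∧ x < n ∧ y < n) ∧
      (x ≤ a - 2 ∨ y ≤ b - 2 ∨ a + 2 ≤ x ∨ b + 2 ≤ y) := by
    intro x y; simp only [O, Set.mem_union, Set.mem_Icc, Prod.mk_le_mk]; omega
  refine isMinor_K5 (B₀ := C) (B₁ := SS T) (B₂ := SS W) (B₃ := SS E) (B₄ := SS O) hC
    ?_ ?_ ?_ ?_ ?_ ?_ ?_ ?_ ?_ ?_ ?_ ?_ ?_ ?_ ?_ ?_ ?_ ?_ ?_ ?_ ?_ ?_ ?_ ?_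
  · exact hrect _ _ _ _ (by omega) (by omega) (by omega) (by omega) (by omega) (by omega)
  · exact hrect _ _ _ _ (by omega) (by omega) (by omega) (by omega) (by omega) (by omega)
  · refine hunion _ _ (hrect _ _ _ _ ?_ ?_ ?_ ?_ ?_ ?_) (hrect _ _ _ _ ?_ ?_ ?_ ?_ ?_ ?_)
      (a + 1, b - 1) ?_ ?_ ?_ <;>
      first | omega | (simp only [InBox, Set.mem_Icc, Prod.mk_le_mk]; omega)
  · refine hunion _ _ (hunion _ _ (hunion _ _ (hrect _ _ _ _ ?_ ?_ ?_ ?_ ?_ ?_)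
      (hrect _ _ _ _ ?_ ?_ ?_ ?_ ?_ ?_) (0, 0) ?_ ?_ ?_) (hrect _ _ _ _ ?_ ?_ ?_ ?_ ?_ ?_)
      (n - 1, 0) ?_ ?_ ?_) (hrect _ _ _ _ ?_ ?_ ?_ ?_ ?_ ?_) (0, n - 1) ?_ ?_ ?_ <;>
      first | omega | (simp only [InBox, Set.mem_union, Set.mem_Icc, Prod.mk_le_mk]; omega)
  · exact hCS _ (by rw [mT]; omega)
  · exact hCS _ (by rw [mW]; omega)
  · exact hCS _ (by rw [mE]; omega)
  · exact hCS _ (by rw [mO]; omega)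
  · exact hSd _ _ (by rintro ⟨x, y⟩; rw [mT, mW]; omega)
  · exact hSd _ _ (by rintro ⟨x, y⟩; rw [mT, mE]; omega)
  · exact hSd _ _ (by rintro ⟨x, y⟩; rw [mT, mO]; omega)
  · exact hSd _ _ (by rintro ⟨x, y⟩; rw [mW, mE]; omega)
  · exact hSd _ _ (by rintro ⟨x, y⟩; rw [mW, mO]; omega)
  · exact hSd _ _ (by rintro ⟨x, y⟩; rw [mE, mO]; omega)
  · exact (hup {(a, b)} T a b rfl ((mT _ _).2 (by omega)) (by omega) (by omega) (by omega)
      (by omega)).mono hSC' subset_rfl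
  · exact ((hright W {(a, b)} (a - 1) b ((mW _ _).2 (by omega)) (by simp) (by omega) (by omega)
      (by omega) (by omega)).mono subset_rfl hSC').symm
  · exact (hright {(a, b)} E a b rfl ((mE _ _).2 (by omega)) (by omega) (by omega) (by omega)
      (by omega)).mono hSC' subset_rfl
  · exact ⟨c, hc, y, hsub O (a', b') ((mO _ _).2 (by omega)) hy, Or.inr hcy⟩
  · exact (hup W T (a - 1) b ((mW _ _).2 (by omega)) ((mT _ _).2 (by omega)) (by omega) (by omega)
      (by omega) (by omega)).symm
  · exact (hup E T (a + 1) b ((mE _ _).2 (by omega)) ((mT _ _).2 (by omega)) (by omega) (by omega)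
      (by omega) (by omega)).symm
  · exact hup T O a (b + 1) ((mT _ _).2 (by omega)) ((mO _ _).2 (by omega)) (by omega) (by omega)
      (by omega) (by omega)
  · exact hright W E (a - 1) (b - 1) ((mW _ _).2 (by omega)) ((mE _ _).2 (by omega)) (by omega)
      (by omega) (by omega) (by omega)
  · exact (hright O W (a - 2) b ((mO _ _).2 (by omega)) ((mW _ _).2 (by omega)) (by omega)
      (by omega) (by omega) (by omega)).symm
  · exact (hup O E a (b - 2) ((mO _ _).2 (by omega)) ((mE _ _).2 (by omega)) (by omega)
      (by omega) (by omega) (by omega)).symm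

/-- In a graph without `K₅` minor, a walk of length `m` from a branch set of a grid minor at
distance more than `m` from the border moves by at most `m` grid steps in each direction. The
vertices outside all branch sets are no shortcuts: in the induction they are added to the last
branch set that has been visited. -/
lemma GridSystem.near_of_walk (h : GridSystem G n S) (hK : ¬ IsMinor (⊤ : SimpleGraph (Fin 5)) G)
    (hdisj : ∀ w w', w ≠ w' → Disjoint (S w) (S w'))
    (hempty : ∀ w, (S w).Nonempty → InBox n w) {x y : U} (p : G.Walk x y) {w w' : ℤ × ℤ}
    (hw : (p.length : ℤ) < w.1 ∧ w.1 + p.length + 1 < n ∧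
      (p.length : ℤ) < w.2 ∧ w.2 + p.length + 1 < n)
    (hx : x ∈ S w) (hy : y ∈ S w') :
    |w.1 - w'.1| ≤ p.length ∧ |w.2 - w'.2| ≤ p.length := by
  let free : ℤ × ℤ → Set U := fun w => S w ∪ (⋃ v, S v)ᶜ
  let hull : ℤ × ℤ → Set U := fun w => {z | ∃ a ∈ S w, Linked G (free w) a z}
  have hSh : ∀ w, S w ⊆ hull w := fun w a ha => ⟨a, ha, .refl (Or.inl ha)⟩
  have hconn : ∀ w, InBox n w → (G.induce (hull w)).Connected := by
    intro w hw
    refine connected_of_core (h.conn w hw) (hSh w) ?_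
    rintro z ⟨a, ha, haz⟩
    have hsub : {u | Linked G (free w) a u} ⊆ hull w := fun u hu => ⟨a, ha, hu⟩
    exact ⟨a, ha, haz.restrict.mono hsub⟩
  have hhull : ∀ w z v, z ∈ hull w → z ∈ S v → v = w := by
    rintro w z v ⟨a, -, haz⟩ hzv
    by_contra hne
    rcases haz.mem_right with hz | hz
    · exact Set.disjoint_left.1 (hdisj v w hne) hzv hz
    · exact hz (Set.mem_iUnion.2 ⟨v, hzv⟩)
  have key : ∀ {x y : U} (p : G.Walk x y) (w : ℤ × ℤ), (p.length : ℤ) < w.1 →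
      w.1 + p.length + 1 < n → (p.length : ℤ) < w.2 → w.2 + p.length + 1 < n →
      x ∈ hull w → y ∈ S w' → |w.1 - w'.1| ≤ p.length ∧ |w.2 - w'.2| ≤ p.length := by
    intro x y p
    induction p with
    | nil =>
      intro w _ _ _ _ hx hy
      obtain rfl := hhull w _ w' hx hy
      simp
    | @cons x z y hxz p ih =>
      intro w h1 h2 h3 h4 hx hy
      rw [SimpleGraph.Walk.length_cons] at h1 h2 h3 h4 ⊢
      push_cast at h1 h2 h3 h4 ⊢
      by_cases hz : z ∈ hull w
      · obtain ⟨e1, e2⟩ := ih w (by omega) (by omega) (by omega) (by omega) hz hy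
        exact ⟨by omega, by omega⟩
      · obtain ⟨v, hzv⟩ : ∃ v, z ∈ S v := by
          by_contra hno
          obtain ⟨a, ha, hax⟩ := hx
          refine hz ⟨a, ha, hax.trans (Linked.of_adj hxz hax.mem_right (Or.inr ?_))⟩
          simpa using hno
        obtain ⟨e1, e2⟩ := h.near_of_adj hK hdisj (w := w) (w' := v)
          ⟨by omega, by omega, by omega, by omega⟩ (hempty v ⟨z, hzv⟩)
          (hconn w ⟨by omega, by omega, by omega, by omega⟩) (hSh w)
          (fun u hu => Set.disjoint_left.2 fun t ht htu => hu (hhull w t u ht htu)) hx hzv hxz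
        rw [abs_le] at e1 e2
        obtain ⟨e3, e4⟩ := ih v (by omega) (by omega) (by omega) (by omega) (hSh v hzv) hy
        rw [abs_le] at e3 e4 ⊢
        rw [abs_le]
        exact ⟨⟨by omega, by omega⟩, by omega, by omega⟩
  exact key p w hw.1 hw.2.1 hw.2.2.1 hw.2.2.2 (hSh w hx) hy

end Systems

/-! ### Coarse grids in overlapping grid systems -/

section Subdivision

/-- A minor from connected sets `Q p` for the vertices of `H` and connected sets `E p q` for its
(oriented) edges, where `E p q` may meet only the sets `Q p` and `Q q`, and where the sets of
different edges may overlap only inside the sets of the vertices. The branch set of `p` consists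
of `Q p` and, for each edge from `p` to `q`, of the part of `E p q` that is reached from `Q p`
before `Q q`. -/
lemma isMinor_of_edge_sets {W U : Type*} {H : SimpleGraph W} {G : SimpleGraph U}
    {R : W → W → Prop} (hR : ∀ p q, H.Adj p q → R p q ∨ R q p)
    {Q : W → Set U} {E : W → W → Set U} (hQ : ∀ p, (G.induce (Q p)).Connected)
    (hE : ∀ p q, R p q → (G.induce (E p q)).Connected)
    (hQd : ∀ p q, p ≠ q → Disjoint (Q p) (Q q))
    (hEl : ∀ p q, R p q → (E p q ∩ Q p).Nonempty) (hEr : ∀ p q, R p q → (E p q ∩ Q q).Nonempty)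
    (hEQ : ∀ p q s, R p q → s ≠ p → s ≠ q → Disjoint (E p q) (Q s))
    (hEE : ∀ p q p' q', R p q → R p' q' → p ≠ p' → E p q ∩ E p' q' ⊆ ⋃ s, Q s) :
    IsMinor H G := by
  -- The part of `E p q` reached from `Q p` before `Q q`.
  let C : W → W → Set U := fun p q => {x | ∃ a ∈ Q p, Linked G (E p q \ Q q) a x}
  let B : W → Set U := fun p => Q p ∪ ⋃ q ∈ {q | R p q}, C p q
  have hCB : ∀ p q, R p q → C p q ⊆ B p := fun p q h =>
    (Set.subset_biUnion_of_mem (u := fun q => C p q) (show q ∈ {q | R p q} from h)).trans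
      Set.subset_union_right
  have hCE : ∀ p q, C p q ⊆ E p q \ Q q := by
    rintro p q x ⟨a, -, h⟩
    exact h.mem_right
  -- The sets `C p q` avoid the sets `Q s` for `s ≠ p`.
  have hCQ : ∀ p q s x, R p q → x ∈ C p q → x ∈ Q s → s = p := by
    intro p q s x h hx hs
    by_contra hsp
    by_cases hsq : s = q
    · exact (hCE p q hx).2 (hsq ▸ hs)
    · exact Set.disjoint_left.1 (hEQ p q s h hsp hsq) (hCE p q hx).1 hs
  refine ⟨B, fun p => connected_of_core (hQ p) Set.subset_union_left ?_, ?_, ?_⟩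
  · rintro x (hx | hx)
    · exact ⟨x, hx, .refl (Or.inl hx)⟩
    · obtain ⟨q, hq, a, ha, hax⟩ := Set.mem_iUnion₂.1 hx
      have hsub : {u | Linked G (E p q \ Q q) a u} ⊆ B p :=
        fun u hu => hCB p q hq ⟨a, ha, hu⟩
      exact ⟨a, ha, hax.restrict.mono hsub⟩
  · intro p p' hpp
    rw [Set.disjoint_left]
    rintro x (hx | hx) (hx' | hx')
    · exact Set.disjoint_left.1 (hQd p p' hpp) hx hx'
    · obtain ⟨q', hq', hx'⟩ := Set.mem_iUnion₂.1 hx'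
      exact hpp (hCQ p' q' p x hq' hx' hx)
    · obtain ⟨q, hq, hx⟩ := Set.mem_iUnion₂.1 hx
      exact hpp (hCQ p q p' x hq hx hx').symm
    · obtain ⟨q, hq, hx⟩ := Set.mem_iUnion₂.1 hx
      obtain ⟨q', hq', hx'⟩ := Set.mem_iUnion₂.1 hx'
      obtain ⟨s, hs⟩ := Set.mem_iUnion.1
        (hEE p q p' q' hq hq' hpp ⟨(hCE p q hx).1, (hCE p' q' hx').1⟩)
      exact hpp ((hCQ p q s x hq hx hs).symm.trans (hCQ p' q' s x hq' hx' hs))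
  · have key : ∀ p q, R p q → p ≠ q → ∃ a ∈ B p, ∃ b ∈ B q, G.Adj a b := by
      intro p q h hpq
      obtain ⟨x, hxE, hxQ⟩ := hEl p q h
      obtain ⟨y, hyE, hyQ⟩ := hEr p q h
      by_contra hno
      -- Otherwise a walk in `E p q` from `Q p` could never leave `C p q`.
      have hl := (linked_of_connected (hE p q h) hxE hyE).2
      have hy : y ∈ C p q := by
        clear hyQ hyE
        induction hl with
        | refl => exact ⟨x, hxQ, .refl ⟨hxE, Set.disjoint_left.1 (hQd p q hpq) hxQ⟩⟩
        | @tail b c _ hbc ih =>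
          obtain ⟨a, ha, hab⟩ := ih
          have hcQ : c ∉ Q q := fun hc =>
            hno ⟨b, hCB p q h ⟨a, ha, hab⟩, c, Or.inl hc, hbc.1⟩
          exact ⟨a, ha, hab.trans (.of_adj hbc.1 hab.mem_right ⟨hbc.2.2, hcQ⟩)⟩
      exact (hCE p q hy).2 hyQ
    intro p q hpq
    rcases hR p q hpq with h | h
    · exact key p q h hpq.ne
    · obtain ⟨a, ha, b, hb, hab⟩ := key q p h hpq.ne'
      exact ⟨b, hb, a, ha, hab.symm⟩

end Subdivision

section Coarsening

variable {U : Type*} {G : SimpleGraph U} {n : ℤ} {S : ℤ × ℤ → Set U}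

/-- A grid system whose sets overlap only for positions at distance at most `k`, except near the
border, yields a coarse grid minor: the vertices are squares of radius `k` around positions with
spacing `4 * k`, the edges are the segments between the centres of the squares. -/
lemma GridSystem.isMinor_grid (h : GridSystem G n S) {k a : ℤ} (hk : 0 < k) (hka : k ≤ a) {t : ℕ}
    (ht : 4 * k * t + 2 * a ≤ n)
    (hloc : ∀ w w', a - k ≤ w.1 → w.1 + a - k < n → a - k ≤ w.2 → w.2 + a - k < n →
      InBox n w' → (S w ∩ S w').Nonempty → |w.1 - w'.1| ≤ k ∧ |w.2 - w'.2| ≤ k) :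
    IsMinor (grid t) G := by
  -- `(X i, X j)` is the centre of the square at the coarse position `(i, j)`.
  let X : ℕ → ℤ := fun i => a + 4 * k * i
  have hXs : ∀ i, X (i + 1) = X i + 4 * k := by
    intro i
    simp only [X]
    push_cast
    ring
  have hXlt : ∀ i j, i < j → X i + 4 * k ≤ X j := by
    intro i j hij
    have : (i : ℤ) + 1 ≤ j := by exact_mod_cast hij
    simp only [X]
    nlinarith
  have hXa : ∀ i, a ≤ X i := fun i => by simp only [X]; nlinarith
  have hXn : ∀ i, i < t → X i + 4 * k + a ≤ n := by
    intro i hi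
    have := hXlt i t hi
    simp only [X] at this ⊢
    linarith
  have hbox : ∀ i j : ℤ, a - k ≤ i → i + a - k < n → a - k ≤ j → j + a - k < n →
      InBox n (i, j) := fun i j _ _ _ _ =>
    ⟨by simp only; omega, by simp only; omega, by simp only; omega, by simp only; omega⟩
  let R : Fin t × Fin t → Fin t × Fin t → Prop := fun p q =>
    ((p.1 : ℕ) + 1 = q.1 ∧ (p.2 : ℕ) = q.2) ∨ ((p.1 : ℕ) = q.1 ∧ (p.2 : ℕ) + 1 = q.2)
  let Q : Fin t × Fin t → Set U := fun p =>
    ⋃ w ∈ Set.Icc (X p.1 - k, X p.2 - k) (X p.1 + k, X p.2 + k), S w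
  let E : Fin t × Fin t → Fin t × Fin t → Set U := fun p q =>
    ⋃ w ∈ Set.Icc (X p.1, X p.2) (X q.1, X q.2), S w
  have hQmem : ∀ p x, x ∈ Q p ↔ ∃ i j : ℤ, (X p.1 - k ≤ i ∧ i ≤ X p.1 + k) ∧
      (X p.2 - k ≤ j ∧ j ≤ X p.2 + k) ∧ x ∈ S (i, j) := by
    intro p x
    simp only [Q, Set.mem_iUnion, Set.mem_Icc, Prod.exists, Prod.mk_le_mk, exists_prop]
    exact ⟨fun ⟨i, j, h, hx⟩ => ⟨i, j, ⟨h.1.1, h.2.1⟩, ⟨h.1.2, h.2.2⟩, hx⟩,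
      fun ⟨i, j, h, h', hx⟩ => ⟨i, j, ⟨⟨h.1, h'.1⟩, h.2, h'.2⟩, hx⟩⟩
  have hEmem : ∀ p q x, x ∈ E p q ↔ ∃ i j : ℤ, (X p.1 ≤ i ∧ i ≤ X q.1) ∧
      (X p.2 ≤ j ∧ j ≤ X q.2) ∧ x ∈ S (i, j) := by
    intro p q x
    simp only [E, Set.mem_iUnion, Set.mem_Icc, Prod.exists, Prod.mk_le_mk, exists_prop]
    exact ⟨fun ⟨i, j, h, hx⟩ => ⟨i, j, ⟨h.1.1, h.2.1⟩, ⟨h.1.2, h.2.2⟩, hx⟩,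
      fun ⟨i, j, h, h', hx⟩ => ⟨i, j, ⟨⟨h.1, h'.1⟩, h.2, h'.2⟩, hx⟩⟩
  have hnear : ∀ i j i' j' : ℤ, a - k ≤ i → i + a - k < n → a - k ≤ j → j + a - k < n →
      a - k ≤ i' → i' + a - k < n → a - k ≤ j' → j' + a - k < n → ∀ x, x ∈ S (i, j) →
      x ∈ S (i', j') → (-k ≤ i - i' ∧ i - i' ≤ k) ∧ (-k ≤ j - j' ∧ j - j' ≤ k) := by
    intro i j i' j' h1 h2 h3 h4 h5 h6 h7 h8 x hx hx'
    have := hloc (i, j) (i', j') h1 h2 h3 h4 (hbox i' j' h5 h6 h7 h8) ⟨x, hx, hx'⟩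
    rwa [abs_le, abs_le] at this
  have hRX : ∀ p q, R p q → (X q.1 = X p.1 + 4 * k ∧ X q.2 = X p.2) ∨
      (X q.1 = X p.1 ∧ X q.2 = X p.2 + 4 * k) := by
    rintro p q (⟨h1, h2⟩ | ⟨h1, h2⟩)
    · exact Or.inl ⟨by rw [← h1, hXs], by rw [h2]⟩
    · exact Or.inr ⟨by rw [h1], by rw [← h2, hXs]⟩
  -- The centres form a grid of spacing `4 * k`.
  have htri : ∀ i j : Fin t, X i + 4 * k ≤ X j ∨ X i = X j ∨ X j + 4 * k ≤ X i := by
    intro i j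
    rcases lt_trichotomy (i : ℕ) j with h | h | h
    · exact Or.inl (hXlt _ _ h)
    · exact Or.inr (Or.inl (by rw [h]))
    · exact Or.inr (Or.inr (hXlt _ _ h))
  have hinj : ∀ p q : Fin t × Fin t, p ≠ q → X p.1 ≠ X q.1 ∨ X p.2 ≠ X q.2 := by
    intro p q hpq
    by_contra! hX
    refine hpq (Prod.ext (Fin.ext ?_) (Fin.ext ?_)) <;> by_contra hne
    · rcases lt_or_gt_of_ne hne with hl | hl <;> have := hXlt _ _ hl <;> omega
    · rcases lt_or_gt_of_ne hne with hl | hl <;> have := hXlt _ _ hl <;> omega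
  refine isMinor_of_edge_sets (R := R) (Q := Q) (E := E) ?_ ?_ ?_ ?_ ?_ ?_ ?_ ?_
  · intro p q hpq
    simp only [grid, SimpleGraph.boxProd_adj, SimpleGraph.pathGraph_adj, Fin.ext_iff] at hpq
    simp only [R]
    omega
  · intro p
    have b1 := hXa p.1
    have b2 := hXa p.2
    have b3 := hXn p.1 p.1.2
    have b4 := hXn p.2 p.2.2
    exact h.connected_rectangle (hbox _ _ (by omega) (by omega) (by omega) (by omega))
      (hbox _ _ (by omega) (by omega) (by omega) (by omega)) ⟨by simp only; omega,
      by simp only; omega⟩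
  · intro p q hpq
    have b1 := hXa p.1
    have b2 := hXa p.2
    have b3 := hXn q.1 q.1.2
    have b4 := hXn q.2 q.2.2
    have b5 := hRX p q hpq
    exact h.connected_rectangle (hbox _ _ (by omega) (by omega) (by omega) (by omega))
      (hbox _ _ (by omega) (by omega) (by omega) (by omega)) ⟨by simp only; omega,
      by simp only; omega⟩
  · intro p q hpq
    rw [Set.disjoint_left]
    intro x hx hx'
    obtain ⟨i, j, hi, hj, hx⟩ := (hQmem _ _).1 hx
    obtain ⟨i', j', hi', hj', hx'⟩ := (hQmem _ _).1 hx'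
    have b1 := hXa p.1
    have b2 := hXa p.2
    have b3 := hXn p.1 p.1.2
    have b4 := hXn p.2 p.2.2
    have b5 := hXa q.1
    have b6 := hXa q.2
    have b7 := hXn q.1 q.1.2
    have b8 := hXn q.2 q.2.2
    have b9 := hnear i j i' j' (by omega) (by omega) (by omega) (by omega) (by omega) (by omega)
      (by omega) (by omega) x hx hx'
    have b10 := htri p.1 q.1
    have b11 := htri p.2 q.2
    have b12 := hinj p q hpq
    omega
  · intro p q hpq
    have b1 := hXa p.1
    have b2 := hXa p.2
    have b3 := hXn p.1 p.1.2
    have b4 := hXn p.2 p.2.2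
    have b5 := hRX p q hpq
    obtain ⟨x, hx⟩ := nonempty_of_connected (h.conn (X p.1, X p.2)
      (hbox _ _ (by omega) (by omega) (by omega) (by omega)))
    exact ⟨x, (hEmem p q x).2 ⟨_, _, by omega, by omega, hx⟩,
      (hQmem p x).2 ⟨_, _, by omega, by omega, hx⟩⟩
  · intro p q hpq
    have b1 := hXa q.1
    have b2 := hXa q.2
    have b3 := hXn q.1 q.1.2
    have b4 := hXn q.2 q.2.2
    have b5 := hRX p q hpq
    obtain ⟨x, hx⟩ := nonempty_of_connected (h.conn (X q.1, X q.2)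
      (hbox _ _ (by omega) (by omega) (by omega) (by omega)))
    exact ⟨x, (hEmem p q x).2 ⟨_, _, by omega, by omega, hx⟩,
      (hQmem q x).2 ⟨_, _, by omega, by omega, hx⟩⟩
  · intro p q s hpq hsp hsq
    rw [Set.disjoint_left]
    intro x hx hx'
    obtain ⟨i, j, hi, hj, hx⟩ := (hEmem _ _ _).1 hx
    obtain ⟨i', j', hi', hj', hx'⟩ := (hQmem _ _).1 hx'
    have b1 := hXa p.1
    have b2 := hXa p.2
    have b3 := hXn q.1 q.1.2
    have b4 := hXn q.2 q.2.2
    have b5 := hXa s.1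
    have b6 := hXa s.2
    have b7 := hXn s.1 s.1.2
    have b8 := hXn s.2 s.2.2
    have b9 := hnear i j i' j' (by omega) (by omega) (by omega) (by omega) (by omega) (by omega)
      (by omega) (by omega) x hx hx'
    have b10 := htri s.1 p.1
    have b11 := htri s.2 p.2
    have b12 := htri s.1 q.1
    have b13 := htri s.2 q.2
    have b14 := hinj s p hsp
    have b15 := hinj s q hsq
    rcases hRX p q hpq with b16 | b16 <;> omega
  · rintro p q p' q' hpq hpq' hpp x ⟨hx, hx'⟩
    obtain ⟨i, j, hi, hj, hx⟩ := (hEmem _ _ _).1 hx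
    obtain ⟨i', j', hi', hj', hx'⟩ := (hEmem _ _ _).1 hx'
    have b1 := hXa p.1
    have b2 := hXa p.2
    have b3 := hXn q.1 q.1.2
    have b4 := hXn q.2 q.2.2
    have b5 := hXa p'.1
    have b6 := hXa p'.2
    have b7 := hXn q'.1 q'.1.2
    have b8 := hXn q'.2 q'.2.2
    have b9 := hnear i j i' j' (by omega) (by omega) (by omega) (by omega) (by omega) (by omega)
      (by omega) (by omega) x hx hx'
    have b10 := htri p.1 p'.1
    have b11 := htri p.2 p'.2
    have b12 := hinj p p' hpp
    -- Two segments come within distance `k` of each other only near an end of the first one.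
    have b13 : ((X p.1 - k ≤ i ∧ i ≤ X p.1 + k) ∧ (X p.2 - k ≤ j ∧ j ≤ X p.2 + k)) ∨
        ((X q.1 - k ≤ i ∧ i ≤ X q.1 + k) ∧ (X q.2 - k ≤ j ∧ j ≤ X q.2 + k)) := by
      rcases hRX p q hpq with b14 | b14 <;> rcases hRX p' q' hpq' with b15 | b15 <;> omega
    rw [Set.mem_iUnion]
    rcases b13 with b13 | b13
    · exact ⟨p, (hQmem p x).2 ⟨i, j, b13.1, b13.2, hx⟩⟩
    · exact ⟨q, (hQmem q x).2 ⟨i, j, b13.1, b13.2, hx⟩⟩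

end Coarsening

/-! ### Disks over the faces of a grid minor -/

section Main

lemma exists_gridSystem_of_isMinor {U : Type*} {G : SimpleGraph U} {n : ℕ}
    (h : IsMinor (grid n) G) :
    ∃ S : ℤ × ℤ → Set U, GridSystem G n S ∧ (∀ w w', w ≠ w' → Disjoint (S w) (S w')) ∧
      ∀ w, (S w).Nonempty → InBox n w := by
  obtain ⟨φ, hconn, hdisj, hadj⟩ := h
  let S : ℤ × ℤ → Set U := fun w =>
    {x | ∃ u : Fin n × Fin n, ((u.1 : ℕ) : ℤ) = w.1 ∧ ((u.2 : ℕ) : ℤ) = w.2 ∧ x ∈ φ u}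
  have hS : ∀ u : Fin n × Fin n, S ((u.1 : ℕ), (u.2 : ℕ)) = φ u := by
    intro u
    ext x
    constructor
    · rintro ⟨u', h1, h2, hx⟩
      have : u' = u := Prod.ext (Fin.ext (Int.ofNat.inj h1)) (Fin.ext (Int.ofNat.inj h2))
      rwa [← this]
    · exact fun hx => ⟨u, rfl, rfl, hx⟩
  have hbox : ∀ w : ℤ × ℤ, InBox n w → ∃ u : Fin n × Fin n,
      w = (((u.1 : ℕ) : ℤ), ((u.2 : ℕ) : ℤ)) := by
    rintro ⟨i, j⟩ ⟨h1, h2, h3, h4⟩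
    simp only at h1 h2 h3 h4
    refine ⟨(⟨i.toNat, by omega⟩, ⟨j.toNat, by omega⟩), ?_⟩
    ext <;> simp only <;> omega
  have htouch : ∀ u u', (grid n).Adj u u' → Touch G (φ u) (φ u') := fun u u' huu =>
    let ⟨a, ha, b, hb, hab⟩ := hadj u u' huu
    ⟨a, ha, b, hb, Or.inr hab⟩
  refine ⟨S, ⟨?_, ?_, ?_⟩, ?_, ?_⟩
  · intro w hw
    obtain ⟨u, rfl⟩ := hbox w hw
    rw [hS]
    exact hconn u
  · intro i j h1 h2
    obtain ⟨u, hu⟩ := hbox _ h1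
    obtain ⟨u', hu'⟩ := hbox _ h2
    rw [hu, hu', hS, hS]
    apply htouch
    simp only [grid, SimpleGraph.boxProd_adj, SimpleGraph.pathGraph_adj, Fin.ext_iff]
    simp only [Prod.mk.injEq] at hu hu'
    omega
  · intro i j h1 h2
    obtain ⟨u, hu⟩ := hbox _ h1
    obtain ⟨u', hu'⟩ := hbox _ h2
    rw [hu, hu', hS, hS]
    apply htouch
    simp only [grid, SimpleGraph.boxProd_adj, SimpleGraph.pathGraph_adj, Fin.ext_iff]
    simp only [Prod.mk.injEq] at hu hu'
    omega
  · intro w w' hww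
    rw [Set.disjoint_left]
    rintro x ⟨u, h1, h2, hx⟩ ⟨u', h3, h4, hx'⟩
    have huu : u ≠ u' := by
      rintro rfl
      exact hww (Prod.ext (h1.symm.trans h3) (h2.symm.trans h4))
    exact Set.disjoint_left.1 (hdisj u u' huu) hx hx'
  · rintro w ⟨x, u, h1, h2, -⟩
    have := u.1.2
    have := u.2.2
    exact ⟨by omega, by omega, by omega, by omega⟩

variable {V : Type*} {D : V → Disk} {G : SimpleGraph V}

/-- The disks containing some face of a set of faces. -/
def disksOver (D : V → Disk) (T : Set (CoveredFace D)) : Set V :=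
  {v | ∃ F ∈ T, F.1 ⊆ (D v).carrier}

lemma eq_or_adj_of_faces (hG : IsRealization D G) {F F' : CoveredFace D}
    (h : F = F' ∨ (arrangementGraph D).Adj F F') {v v' : V} (hv : F.1 ⊆ (D v).carrier)
    (hv' : F'.1 ⊆ (D v').carrier) : v = v' ∨ G.Adj v v' := by
  by_cases hvv : v = v'
  · exact Or.inl hvv
  refine Or.inr ((hG.adj_iff v v' hvv).2 ?_)
  rcases h with rfl | ⟨-, a, ha, ⟨⟨x, hx⟩, -⟩, -⟩
  · obtain ⟨x, hx⟩ := F.2.1.nonempty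
    exact ⟨x, hv hx, hv' hx⟩
  · -- A common boundary point of the faces lies in both disks, which are closed.
    exact ⟨x, closure_minimal hv Metric.isClosed_closedBall (frontier_subset_closure (ha hx).1),
      closure_minimal hv' Metric.isClosed_closedBall (frontier_subset_closure (ha hx).2)⟩

lemma touch_disksOver (hG : IsRealization D G) {T T' : Set (CoveredFace D)}
    (h : Touch (arrangementGraph D) T T') : Touch G (disksOver D T) (disksOver D T') := by
  obtain ⟨F, hF, F', hF', h⟩ := h
  obtain ⟨v, hv⟩ := F.2.2
  obtain ⟨v', hv'⟩ := F'.2.2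
  exact ⟨v, ⟨F, hF, hv⟩, v', ⟨F', hF', hv'⟩, eq_or_adj_of_faces hG h hv hv'⟩

/-- The disks over a connected set of faces are connected: the disks over one face form a clique,
and disks over adjacent faces intersect. -/
lemma connected_disksOver (hG : IsRealization D G) {T : Set (CoveredFace D)}
    (hT : ((arrangementGraph D).induce T).Connected) : (G.induce (disksOver D T)).Connected := by
  refine connected_induce_iff.2 ⟨?_, ?_⟩
  · obtain ⟨F, hF⟩ := nonempty_of_connected hT
    obtain ⟨v, hv⟩ := F.2.2
    exact ⟨v, F, hF, hv⟩
  · have step : ∀ F ∈ T, ∀ F' ∈ T, (F = F' ∨ (arrangementGraph D).Adj F F') →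
        ∀ v v', F.1 ⊆ (D v).carrier → F'.1 ⊆ (D v').carrier →
        Linked G (disksOver D T) v v' := by
      intro F hF F' hF' h v v' hv hv'
      rcases eq_or_adj_of_faces hG h hv hv' with rfl | hadj
      · exact .refl ⟨F, hF, hv⟩
      · exact .of_adj hadj ⟨F, hF, hv⟩ ⟨F', hF', hv'⟩
    rintro v ⟨F, hF, hv⟩ v' ⟨F', hF', hv'⟩
    have hl := (linked_of_connected hT hF hF').2
    clear hF'
    induction hl generalizing v' with
    | refl => exact step F hF F hF (Or.inl rfl) v v' hv hv'
    | @tail A B _ hAB ih =>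
      obtain ⟨u, hu⟩ := A.2.2
      exact (ih u hu).trans (step A hAB.2.1 B hAB.2.2 (Or.inr hAB.1) u v' hu hv')

/-- Two faces in the same disk are joined by a walk of length at most twice the local radius. -/
lemma exists_walk_of_localRadius {r : ℕ} (hr : localRadius D ≤ r) {v : V} {F F' : CoveredFace D}
    (hF : F.1 ⊆ (D v).carrier) (hF' : F'.1 ⊆ (D v).carrier) :
    ∃ p : (arrangementGraph D).Walk F F', p.length ≤ 2 * r := by
  have hv : (arrangementGraphIn D (D v).carrier).radius ≤ r :=
    (le_iSup (fun v => (arrangementGraphIn D (D v).carrier).radius) v).trans hr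
  have : Nonempty {F : CoveredFace D | F.1 ⊆ (D v).carrier} := ⟨⟨F, hF⟩⟩
  obtain ⟨z, hz⟩ := (arrangementGraphIn D (D v).carrier).exists_eccent_eq_radius
  have key : ∀ A : CoveredFace D, ∀ _ : A.1 ⊆ (D v).carrier,
      ∃ p : (arrangementGraph D).Walk z.1 A, p.length ≤ r := by
    intro A hA
    have hle : (arrangementGraphIn D (D v).carrier).edist z ⟨A, hA⟩ ≤ r :=
      (SimpleGraph.edist_le_eccent).trans (hz.le.trans hv)
    obtain ⟨p, hp⟩ := SimpleGraph.exists_walk_of_edist_ne_top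
      (ne_top_of_le_ne_top (ENat.natCast_ne_top r) hle)
    let f : arrangementGraphIn D (D v).carrier →g arrangementGraph D := ⟨Subtype.val, fun h => h⟩
    refine ⟨p.map f, ?_⟩
    rw [SimpleGraph.Walk.length_map]
    rw [← hp] at hle
    exact_mod_cast hle
  obtain ⟨p, hp⟩ := key F hF
  obtain ⟨p', hp'⟩ := key F' hF'
  refine ⟨p.reverse.append p', ?_⟩
  rw [SimpleGraph.Walk.length_append, SimpleGraph.Walk.length_reverse]
  omega

/-- A single vertex is a `1 × 1` grid minor. -/
lemma isMinor_grid_one {U : Type*} {G : SimpleGraph U} (x : U) : IsMinor (grid 1) G := by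
  refine ⟨fun _ => {x}, fun _ => connected_induce_iff.2 ⟨⟨x, rfl⟩, ?_⟩, ?_, ?_⟩
  · rintro _ rfl _ rfl
    exact .refl rfl
  · exact fun w w' h => absurd (Subsingleton.elim w w') h
  · exact fun w w' h => absurd (Subsingleton.elim w w') h.ne

/-- The sets of disks over the branch sets form a grid system that overlaps only within
distance `2 * R`. -/
theorem isMinor_grid_of_arrangement [Finite V] (hG : IsRealization D G) {r : ℕ}
    (hr : localRadius D ≤ r) {n : ℕ} (hn : IsMinor (grid n) (arrangementGraph D)) {R : ℕ}
    (hrR : r ≤ R) (hR : 0 < R) {t : ℕ} (ht : 8 * R * t + 8 * R + 2 ≤ n) :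
    IsMinor (grid t) G := by
  obtain ⟨S, hS, hdisj, hempty⟩ := exists_gridSystem_of_isMinor hn
  have hX : GridSystem G n fun w => disksOver D (S w) :=
    ⟨fun w hw => connected_disksOver hG (hS.conn w hw),
      fun i j h h' => touch_disksOver hG (hS.right i j h h'),
      fun i j h h' => touch_disksOver hG (hS.up i j h h')⟩
  refine hX.isMinor_grid (k := 2 * R) (a := 4 * R + 1) (by omega) (by omega) ?_ ?_
  · have : 8 * (R : ℤ) * t + 8 * R + 2 ≤ n := by exact_mod_cast ht
    linarith
  · rintro w w' h1 h2 h3 h4 - ⟨v, ⟨F, hF, hv⟩, F', hF', hv'⟩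
    obtain ⟨p, hp⟩ := exists_walk_of_localRadius hr hv hv'
    obtain ⟨e1, e2⟩ := hS.near_of_walk (not_isMinor_K5_arrangementGraph hG.generalPosition)
      hdisj hempty p (w := w) (w' := w') ⟨by omega, by omega, by omega, by omega⟩ hF hF'
    exact ⟨by omega, by omega⟩

end Main

end DiskGrid

theorem mainTheorem4 :
    ∃ c : ℝ, 0 < c ∧
      ∀ {V : Type*} [Finite V] (G : SimpleGraph V) (D : V → DiskGrid.Disk),
        DiskGrid.IsRealization D G →
        ∀ r : ℕ, DiskGrid.localRadius D = (r : ℕ∞) →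
        ∀ t' : ℕ, DiskGrid.IsMinor (DiskGrid.grid t') (DiskGrid.arrangementGraph D) →
          ∃ t : ℕ, c * ((t' : ℝ) / (max r 1 : ℕ)) ≤ (t : ℝ) ∧
            DiskGrid.IsMinor (DiskGrid.grid t) G := by
  refine ⟨1 / 36, by norm_num, fun {V} _ G D hG r hr n hn => ?_⟩
  set R := max r 1
  have hR : 0 < R := lt_max_of_lt_right one_pos
  have hRr : (0 : ℝ) < R := by exact_mod_cast hR
  -- It suffices that `t * R` is at least `n / 36`.
  have hsuff : ∀ t : ℕ, n ≤ 36 * (R * t) → 1 / 36 * ((n : ℝ) / R) ≤ t := by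
    intro t ht
    have : (n : ℝ) ≤ 36 * (R * t) := by exact_mod_cast ht
    rw [← mul_div_assoc, div_le_iff₀ hRr]
    linarith
  rcases Nat.eq_zero_or_pos n with rfl | hpos
  · exact ⟨0, by simp, fun w => w.1.elim0, fun w => w.1.elim0, fun w => w.1.elim0,
      fun w => w.1.elim0⟩
  rcases lt_or_ge n (18 * R) with hlt | hge
  · -- A small grid in the arrangement graph still provides a disk.
    obtain ⟨φ, hφ, -⟩ := hn
    obtain ⟨F⟩ := (hφ (⟨0, hpos⟩, ⟨0, hpos⟩)).nonempty
    obtain ⟨v, -⟩ := F.1.2.2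
    exact ⟨1, hsuff 1 (by omega), DiskGrid.isMinor_grid_one v⟩
  · -- For `t ≥ 1`, the order `18 * R * t` leaves room for the border of the coarse `t × t` grid, as
    -- `8 * R * t + 8 * R + 2 ≤ 18 * R * t`; rounding `n / (18 * R)` down loses at most a factor 2.
    have h1 : 18 * R * (n / (18 * R)) ≤ n := Nat.mul_div_le n (18 * R)
    have h2 : n < 18 * R * (n / (18 * R) + 1) :=
      Nat.lt_mul_div_succ n (by omega)
    have h3 : 1 ≤ n / (18 * R) := (Nat.one_le_div_iff (by omega)).2 hge
    set t := n / (18 * R)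
    have h4 : R ≤ R * t := Nat.le_mul_of_pos_right R h3
    refine ⟨t, hsuff t ?_, DiskGrid.isMinor_grid_of_arrangement hG hr.le hn (le_max_left r 1) hR
      (R := R) (t := t) ?_⟩ <;> nlinarith
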